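/- **Theorem.** A *line arrangement* is a finite set $\mathcal A$ of lines in $\mathbb P^2=\mathbb P^2(\mathbb C)$. For $i\ge 2$ let $t_i(\mathcal A)$ be the number of points lying on exactly $i$ lines of $\mathcal A$; two arrangements have the *same weak combinatorics* if they have the same number of lines and the same $t_i$ for all $i\ge2$. Let $S=\mathbb C[x,y,z]$, let $f\in S$ be the product of linear forms defining the lines of $\mathcal A$, and let $$T(\mathcal A)=\{(\theta_0,\theta_1,\theta_2)\in S^3:\ \theta_0\,\partial_xf+\theta_1\,\partial_yf+\theta_2\,\partial_zf=0\},$$ the graded $S$-module of twisted global sections of the sheaf $\mathcal T_{\mathcal A}$ of vector fields tangent to $\mathcal A$. $\mathcal A$ is *free with exponents* $(a,b)$ if $T(\mathcal A)\cong S(-a)\oplus S(-b)$ as graded modules (equivalently $\mathcal T_{\mathcal A}\cong\mathcal O_{\mathbb P^2}(-a)\oplus\mathcal O_{\mathbb P^2}(-b)$), and *free* if this holds for some $(a,b)$. It is *nearly free with exponents* $(a,b)$, $a\le b$, if $T(\mathcal A)$ has a graded free resolution $0\to S(-b-1)\to S(-a)\oplus S(-b)^2\to T(\mathcal A)\to0$.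 $\mathcal A\in\mathrm{Tr}(a,b,c)$ means that there are three non-aligned points such that every line of $\mathcal A$ passes through at least one of them, the three lines joining them belong to $\mathcal A$, and exactly $a+1$, $b+1$, $c+1$ lines of $\mathcal A$, respectively, pass through them. Finally, $\mathcal A^3_3(N)$ is the arrangement $xyz(x^N-y^N)(y^N-z^N)(x^N-z^N)=0$. There exist two line arrangements with the same weak combinatorics such that one is free and the other is not. Explicitly: 1. For every primitive sixth root of unity $\zeta$, let $\mathcal A_0$ be obtained from $\mathcal A^3_3(6)$ by removing the six lines $x=z$, $x=\zeta z$, $y=z$, $y=\zeta z$, $x=\zeta^2y$, $x=\zeta^4y$. Then $\mathcal A_0$ consists of $15$ lines, belongs to $\mathrm{Tr}(5,5,5)$, has $t_2=24$, $t_3=12$, $t_6=3$ and all other $t_i=0$ ($i\ge2$), and is free with exponents $(7,7)$. 2. Let $\mathcal A_1$ be obtained from $\mathcal A^3_3(5)$ by removing the three lines $x=z$, $y=z$, $x=y$. Then $\mathcal A_1$ consists of $15$ lines, belongs to $\mathrm{Tr}(5,5,5)$, has $t_2=24$, $t_3=12$, $t_6=3$ and all other $t_i=0$ ($i\ge2$),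 and is not free, but nearly free with exponents $(6,9)$. -/

import Mathlib

open scoped LinearAlgebra.Projectivization

noncomputable section

namespace LineArr

/-- Points of the complex projective plane. -/
abbrev Point := ℙ ℂ (Fin 3 → ℂ)

/-- Lines of the complex projective plane, as points of the dual plane: the class of `(a, b, c)`
is the line `a x + b y + c z = 0`. -/
abbrev Line := ℙ ℂ (Fin 3 → ℂ)

/-- The point `p` lies on the line `l`. -/
def Passes (l : Line) (p : Point) : Prop := Projectivization.orthogonal l p

/-- A line arrangement: a finite set of (distinct) lines. -/
abbrev Arrangement := Finset Line

/-- The homogeneous coordinate ring `ℂ[x, y, z]` of the plane. -/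
abbrev Poly := MvPolynomial (Fin 3) ℂ

/-! ### Multiple points and weak combinatorics -/

/-- The multiplicity of `p` in `A`: the number of lines of `A` through `p`. -/
def multiplicity (A : Arrangement) (p : Point) : ℕ := {l : Line | l ∈ A ∧ Passes l p}.ncard

/-- The number `t_i` of points of multiplicity exactly `i` (meaningful for `2 ≤ i`, where the set
of these points is finite). -/
def t (A : Arrangement) (i : ℕ) : ℕ := {p : Point | multiplicity A p = i}.ncard

/-- Same number of lines and same numbers `t_i`, `i ≥ 2`. -/
def SameWeakCombinatorics (A B : Arrangement) : Prop :=
  A.card = B.card ∧ ∀ i, 2 ≤ i → t A i = t B i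

/-! ### Freeness -/

/-- A linear form defining the line `l` (unique up to a nonzero scalar). -/
def linearForm (l : Line) : Poly := ∑ i, MvPolynomial.C (l.rep i) * MvPolynomial.X i

/-- The defining polynomial `f` of the arrangement (unique up to a nonzero scalar). -/
def definingPoly (A : Arrangement) : Poly := ∏ l ∈ A, linearForm l

/-- The kernel of the Jacobian map `∇ f : S³ → S`, i.e. the graded `S`-module of all
`(θ₀, θ₁, θ₂)` with `θ₀ ∂f/∂x + θ₁ ∂f/∂y + θ₂ ∂f/∂z = 0`. This is the module of all twisted global
sections of the sheaf of vector fields tangent to `A`, and does not depend on the scalar in `f`. -/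
def tangentModule (A : Arrangement) : Submodule Poly (Fin 3 → Poly) :=
  LinearMap.ker
    (Fintype.linearCombination Poly (fun i : Fin 3 => MvPolynomial.pderiv i (definingPoly A)))

/-- A tangent field is homogeneous of degree `d` if its three coefficients are. -/
def IsHomogeneousField {A : Arrangement} (θ : tangentModule A) (d : ℕ) : Prop :=
  ∀ i, (θ.1 i).IsHomogeneous d

/-- `A` is free with exponents `(a, b)`: the tangent module has a basis made of two homogeneous
elements of degrees `a` and `b`, i.e. it is `S(-a) ⊕ S(-b)` as a graded module. -/
def IsFreeWithExponents (A : Arrangement) (a b : ℕ) : Prop :=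
  ∃ β : Module.Basis (Fin 2) Poly (tangentModule A),
    IsHomogeneousField (β 0) a ∧ IsHomogeneousField (β 1) b

/-- `A` is free. -/
def IsFree (A : Arrangement) : Prop := ∃ a b, IsFreeWithExponents A a b

/-- `A` is nearly free with exponents `a ≤ b`: the tangent module has a graded free resolution
`0 → S(-b-1) → S(-a) ⊕ S(-b)² → tangentModule A → 0`. Here `θ` lists the three homogeneous
generators, and `r` is the one relation that generates all the relations between them. -/
def IsNearlyFreeWithExponents (A : Arrangement) (a b : ℕ) : Prop :=
  a ≤ b ∧ ∃ (θ : Fin 3 → tangentModule A) (r : Fin 3 → Poly),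
    IsHomogeneousField (θ 0) a ∧ IsHomogeneousField (θ 1) b ∧ IsHomogeneousField (θ 2) b ∧
    Submodule.span Poly (Set.range θ) = ⊤ ∧
    (r 0).IsHomogeneous (b + 1 - a) ∧ (r 1).IsHomogeneous 1 ∧ (r 2).IsHomogeneous 1 ∧
    r ≠ 0 ∧
    ∀ c : Fin 3 → Poly, ∑ i, c i • θ i = 0 ↔ ∃ h : Poly, c = h • r

/-! ### Triangular arrangements -/

/-- `A ∈ Tr(a, b, c)`: there are three non-aligned points `P`, `Q`, `R` such that every line of `A`
passes through one of them, the three side lines belong to `A`, and `a + 1`, `b + 1`, `c + 1`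
lines of `A` (sides included) pass through `P`, `Q`, `R` respectively. -/
def IsTriangular (A : Arrangement) (a b c : ℕ) : Prop :=
  ∃ P Q R : Point, Projectivization.Independent ![P, Q, R] ∧
    (∀ l ∈ A, Passes l P ∨ Passes l Q ∨ Passes l R) ∧
    (∀ l : Line, (Passes l P ∧ Passes l Q) ∨ (Passes l Q ∧ Passes l R) ∨
      (Passes l P ∧ Passes l R) → l ∈ A) ∧
    multiplicity A P = a + 1 ∧ multiplicity A Q = b + 1 ∧ multiplicity A R = c + 1

/-! ### Full monomial arrangements -/

/-- The line `x = 0`. -/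
def lineX : Line := Projectivization.mk ℂ ![1, 0, 0] (fun h => by simpa using congrFun h 0)

/-- The line `y = 0`. -/
def lineY : Line := Projectivization.mk ℂ ![0, 1, 0] (fun h => by simpa using congrFun h 1)

/-- The line `z = 0`. -/
def lineZ : Line := Projectivization.mk ℂ ![0, 0, 1] (fun h => by simpa using congrFun h 2)

/-- The line `x = α y`. -/
def lineXY (α : ℂ) : Line :=
  Projectivization.mk ℂ ![1, -α, 0] (fun h => by simpa using congrFun h 0)

/-- The line `y = α z`. -/
def lineYZ (α : ℂ) : Line :=
  Projectivization.mk ℂ ![0, 1, -α] (fun h => by simpa using congrFun h 1)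

/-- The line `x = α z`. -/
def lineXZ (α : ℂ) : Line :=
  Projectivization.mk ℂ ![1, 0, -α] (fun h => by simpa using congrFun h 0)

open Classical in
/-- The full monomial arrangement `A³₃(N)`, with equation
`x y z (x ^ N - y ^ N) (y ^ N - z ^ N) (x ^ N - z ^ N) = 0`: the three sides and the lines
`x = ω y`, `y = ω z`, `x = ω z` for all `N`-th roots of unity `ω`. -/
def fullMonomial (N : ℕ) : Arrangement :=
  {lineX, lineY, lineZ} ∪ (Polynomial.nthRootsFinset N (1 : ℂ)).image lineXY ∪
    (Polynomial.nthRootsFinset N (1 : ℂ)).image lineYZ ∪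
    (Polynomial.nthRootsFinset N (1 : ℂ)).image lineXZ

open Classical in
/-- `A³₃(6)` without the lines `x = z`, `x = ζ z`, `y = z`, `y = ζ z`, `x = ζ² y`, `x = ζ⁴ y`
(for a primitive sixth root of unity `ζ`). -/
def exampleA₀ (ζ : ℂ) : Arrangement :=
  fullMonomial 6 \
    {lineXZ 1, lineXZ ζ, lineYZ 1, lineYZ ζ, lineXY (ζ ^ 2), lineXY (ζ ^ 4)}

open Classical in
/-- `A³₃(5)` without the lines `x = z`, `y = z`, `x = y`. -/
def exampleA₁ : Arrangement := fullMonomial 5 \ {lineXZ 1, lineYZ 1, lineXY 1}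

end LineArr

end

/-!
Both arrangements consist of the coordinate triangle and of three pencils of four lines
`x = a y`, `y = b z`, `x = c z` through its vertices, with slopes `a ∈ I`, `b ∈ J`, `c ∈ K`. Write
`P(x, y)`, `Q(y, z)`, `R(x, z)` for the binary forms of the three pencils.

*Tangent fields are syzygies.* A field tangent to the arrangement preserves the sides, so it is
`(x g₀, y g₁, z g₂)`; it preserves the other lines if and only if `P ∣ g₀ - g₁`, `Q ∣ g₁ - g₂` and
`R ∣ g₂ - g₀`. The three quotients form a syzygy of `(P, Q, R)`, and conversely a syzygy determines
the `gᵢ` up to a common summand, which is fixed by the condition that the field kills the defining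
polynomial and not merely multiplies it. Hence the tangent module is the module of syzygies of
`(P, Q, R)`, with degrees raised by `5` (`syzygiesEquiv`).

*The free arrangement.* For `exampleA₀` the forms `P`, `Q`, `R` are the `2 × 2` minors of a
`3 × 2` matrix of quadrics, so by Cramer's rule (the easy half of the Hilbert–Burch theorem,
`exists_basis_syzygies`) its two columns are a basis of the syzygies.

*The nearly free arrangement.* For `exampleA₁` the forms are `(x⁵ - y⁵) / (x - y)` and its
analogues, so `(x - y) P + (y - z) Q + (z - x) R = 0`. Moreover `P - R = (y - z) H` and
`Q - R = -(x - y) H` for a cubic `H` coprime to `R`, and this shows that the linear syzygy and two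
Koszul syzygies generate, with one relation between them (`exists_eq_linearKoszul`,
`linearKoszul_relation`). The coefficients of this relation have no constant term, so the three
generators are minimal and the module, of rank two, is not free
(`IsNearlyFreeWithExponents.not_isFree`).

*Combinatorics.* The vertices have multiplicity `6`, each line of a pencil meets the opposite side
in a double point, and the other multiple points are determined by the number of pairs
`(c, b) ∈ K × J` with `c / b ∈ I`. In both cases the slopes are powers of a root of unity, and
counting exponents gives `12` such pairs.
-/

open scoped LinearAlgebra.Projectivization

namespace LineArr

open MvPolynomial

/-! ### Triangular arrangements with given slopes -/

open Classical in
/-- The arrangement made of the three coordinate lines and of the lines `x = a y`, `y = b z`,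
`x = c z` with `a ∈ I`, `b ∈ J`, `c ∈ K`. -/
noncomputable def slopeArrangement (I J K : Finset ℂ) : Arrangement :=
  {lineX, lineY, lineZ} ∪ I.image lineXY ∪ J.image lineYZ ∪ K.image lineXZ

lemma mk_eq_mk_iff_cross {v w : Fin 3 → ℂ} (hv : v ≠ 0) (hw : w ≠ 0) :
    Projectivization.mk ℂ v hv = Projectivization.mk ℂ w hw ↔
      v 1 * w 2 = v 2 * w 1 ∧ v 2 * w 0 = v 0 * w 2 ∧ v 0 * w 1 = v 1 * w 0 := by
  rw [Projectivization.mk_eq_mk_iff_crossProduct_eq_zero, cross_apply]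
  simp [sub_eq_zero]

lemma lineXY_injective : Function.Injective lineXY := fun a b h => by
  simpa [lineXY, mk_eq_mk_iff_cross, eq_comm] using h

lemma lineYZ_injective : Function.Injective lineYZ := fun a b h => by
  simpa [lineYZ, mk_eq_mk_iff_cross, eq_comm] using h

lemma lineXZ_injective : Function.Injective lineXZ := fun a b h => by
  simpa [lineXZ, mk_eq_mk_iff_cross, eq_comm] using h

@[to_additive]
lemma prod_slopeArrangement {M : Type*} [CommMonoid M] {I J K : Finset ℂ}
    (hI : (0 : ℂ) ∉ I) (hJ : (0 : ℂ) ∉ J) (hK : (0 : ℂ) ∉ K) (f : Line → M) :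
    ∏ l ∈ slopeArrangement I J K, f l = f lineX * f lineY * f lineZ *
      (∏ a ∈ I, f (lineXY a)) * (∏ b ∈ J, f (lineYZ b)) * ∏ c ∈ K, f (lineXZ c) := by
  classical
  have hI' : ∀ a ∈ I, a ≠ 0 := fun a ha h => hI (h ▸ ha)
  have hJ' : ∀ a ∈ J, a ≠ 0 := fun a ha h => hJ (h ▸ ha)
  have hK' : ∀ a ∈ K, a ≠ 0 := fun a ha h => hK (h ▸ ha)
  have e : slopeArrangement I J K =
      {lineX, lineY, lineZ} ∪ I.image lineXY ∪ J.image lineYZ ∪ K.image lineXZ := by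
    ext; simp [slopeArrangement]
  rw [e, Finset.prod_union, Finset.prod_union, Finset.prod_union,
    Finset.prod_image lineXY_injective.injOn, Finset.prod_image lineYZ_injective.injOn,
    Finset.prod_image lineXZ_injective.injOn, Finset.prod_insert, Finset.prod_insert,
    Finset.prod_singleton]
  · simp only [mul_assoc]
  · simp [lineY, lineZ, mk_eq_mk_iff_cross]
  · simp [lineX, lineY, lineZ, mk_eq_mk_iff_cross]
  all_goals
    rw [Finset.disjoint_left]
    simp only [Finset.mem_union, Finset.mem_insert, Finset.mem_singleton, Finset.mem_image,
      not_exists, not_and]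
    rintro l hl a ha rfl
    simp only [lineX, lineY, lineZ, lineXY, lineYZ, lineXZ, mk_eq_mk_iff_cross] at hl
    have := hI' a
    have := hJ' a
    have := hK' a
    simp_all

lemma card_slopeArrangement {I J K : Finset ℂ}
    (hI : (0 : ℂ) ∉ I) (hJ : (0 : ℂ) ∉ J) (hK : (0 : ℂ) ∉ K) :
    (slopeArrangement I J K).card = 3 + I.card + J.card + K.card := by
  rw [Finset.card_eq_sum_ones, sum_slopeArrangement hI hJ hK]
  simp

lemma mem_slopeArrangement {I J K : Finset ℂ} {l : Line} :
    l ∈ slopeArrangement I J K ↔ (l = lineX ∨ l = lineY ∨ l = lineZ) ∨ (∃ a ∈ I, lineXY a = l) ∨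
      (∃ b ∈ J, lineYZ b = l) ∨ ∃ c ∈ K, lineXZ c = l := by
  simp [slopeArrangement, or_assoc]

lemma slopeArrangement_sdiff {I J K I' J' K' : Finset ℂ} [DecidableEq Line]
    (hI : (0 : ℂ) ∉ I) (hJ : (0 : ℂ) ∉ J) (hK : (0 : ℂ) ∉ K) (hI' : I' ⊆ I) (hJ' : J' ⊆ J)
    (hK' : K' ⊆ K) (s : Finset Line)
    (hs : ∀ l, l ∈ s ↔ (∃ a ∈ I', lineXY a = l) ∨ (∃ b ∈ J', lineYZ b = l) ∨
      ∃ c ∈ K', lineXZ c = l) :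
    slopeArrangement I J K \ s = slopeArrangement (I \ I') (J \ J') (K \ K') := by
  have h1 : ∀ a ∈ I, a ≠ 0 := fun a ha h => hI (h ▸ ha)
  have h2 : ∀ a ∈ J, a ≠ 0 := fun a ha h => hJ (h ▸ ha)
  have h3 : ∀ a ∈ K, a ≠ 0 := fun a ha h => hK (h ▸ ha)
  have h1' : (0 : ℂ) ∉ I' := fun h => hI (hI' h)
  have h2' : (0 : ℂ) ∉ J' := fun h => hJ (hJ' h)
  have h3' : (0 : ℂ) ∉ K' := fun h => hK (hK' h)
  ext l
  simp only [Finset.mem_sdiff, mem_slopeArrangement, hs]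
  constructor
  · rintro ⟨h | ⟨a, ha, rfl⟩ | ⟨a, ha, rfl⟩ | ⟨a, ha, rfl⟩, h'⟩
    · exact Or.inl h
    · exact Or.inr (Or.inl ⟨a, ⟨ha, fun h => h' (Or.inl ⟨a, h, rfl⟩)⟩, rfl⟩)
    · exact Or.inr (Or.inr (Or.inl ⟨a, ⟨ha, fun h => h' (Or.inr (Or.inl ⟨a, h, rfl⟩))⟩, rfl⟩))
    · exact Or.inr (Or.inr (Or.inr ⟨a, ⟨ha, fun h => h' (Or.inr (Or.inr ⟨a, h, rfl⟩))⟩, rfl⟩))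
  · rintro (h | ⟨a, ⟨ha, ha'⟩, rfl⟩ | ⟨a, ⟨ha, ha'⟩, rfl⟩ | ⟨a, ⟨ha, ha'⟩, rfl⟩)
    · refine ⟨Or.inl h, ?_⟩
      rintro (⟨b, hb, rfl⟩ | ⟨b, hb, rfl⟩ | ⟨b, hb, rfl⟩) <;>
        simp [lineX, lineY, lineZ, lineXY, lineYZ, lineXZ, mk_eq_mk_iff_cross] at h <;>
        subst h <;> contradiction
    · refine ⟨Or.inr (Or.inl ⟨a, ha, rfl⟩), ?_⟩
      rintro (⟨b, hb, h⟩ | ⟨b, hb, h⟩ | ⟨b, hb, h⟩) <;>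
        simp [lineXY, lineYZ, lineXZ, mk_eq_mk_iff_cross] at h <;> simp_all
    · refine ⟨Or.inr (Or.inr (Or.inl ⟨a, ha, rfl⟩)), ?_⟩
      rintro (⟨b, hb, h⟩ | ⟨b, hb, h⟩ | ⟨b, hb, h⟩) <;>
        simp [lineXY, lineYZ, lineXZ, mk_eq_mk_iff_cross] at h
      all_goals simp_all
    · refine ⟨Or.inr (Or.inr (Or.inr ⟨a, ha, rfl⟩)), ?_⟩
      rintro (⟨b, hb, h⟩ | ⟨b, hb, h⟩ | ⟨b, hb, h⟩) <;>
        simp [lineXY, lineYZ, lineXZ, mk_eq_mk_iff_cross] at h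
      all_goals simp_all

/-! ### Multiplicities of points -/

open Classical in
lemma multiplicity_slopeArrangement {I J K : Finset ℂ}
    (hI : (0 : ℂ) ∉ I) (hJ : (0 : ℂ) ∉ J) (hK : (0 : ℂ) ∉ K) (x y z : ℂ)
    (hv : (![x, y, z] : Fin 3 → ℂ) ≠ 0) :
    multiplicity (slopeArrangement I J K) (Projectivization.mk ℂ ![x, y, z] hv) =
      (if x = 0 then 1 else 0) + (if y = 0 then 1 else 0) + (if z = 0 then 1 else 0) +
      (I.filter fun a => x = a * y).card + (J.filter fun b => y = b * z).card +
      (K.filter fun c => x = c * z).card := by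
  have h : {l : Line | l ∈ slopeArrangement I J K ∧
      Passes l (Projectivization.mk ℂ ![x, y, z] hv)} =
      ((slopeArrangement I J K).filter fun l => Passes l (Projectivization.mk ℂ ![x, y, z] hv) :
        Finset Line) := by ext; simp
  rw [multiplicity, h, Set.ncard_coe_finset, Finset.card_filter, sum_slopeArrangement hI hJ hK,
    ← Finset.card_filter, ← Finset.card_filter, ← Finset.card_filter]
  simp only [Passes, lineX, lineY, lineZ, lineXY, lineYZ, lineXZ, Projectivization.orthogonal_mk,
    dotProduct, Fin.sum_univ_three]
  simp [← sub_eq_add_neg, sub_eq_zero]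

/-- The point `(x : y : 1)` of the affine chart `z ≠ 0`. -/
noncomputable def affinePoint (q : ℂ × ℂ) : Point :=
  Projectivization.mk ℂ ![q.1, q.2, 1] (fun h => by simpa using congrFun h 2)

/-- The point `(s : 1 : 0)` of the side `z = 0`. -/
noncomputable def sidePoint (s : ℂ) : Point :=
  Projectivization.mk ℂ ![s, 1, 0] (fun h => by simpa using congrFun h 1)

/-- The vertex `(1 : 0 : 0)`. -/
noncomputable def vertexX : Point :=
  Projectivization.mk ℂ ![1, 0, 0] (fun h => by simpa using congrFun h 0)

/-- The plane is the disjoint union of an affine plane, an affine line and a point. -/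
lemma point_cases (p : Point) :
    (∃ q, p = affinePoint q) ∨ (∃ s, p = sidePoint s) ∨ p = vertexX := by
  induction p using Projectivization.ind with | h v hv =>
  by_cases h2 : v 2 = 0
  · by_cases h1 : v 1 = 0
    · refine Or.inr (Or.inr ?_)
      simp [vertexX, mk_eq_mk_iff_cross, h1, h2]
    · refine Or.inr (Or.inl ⟨v 0 / v 1, ?_⟩)
      simp [sidePoint, mk_eq_mk_iff_cross, h2]
      field_simp
  · refine Or.inl ⟨(v 0 / v 2, v 1 / v 2), ?_⟩
    simp [affinePoint, mk_eq_mk_iff_cross]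
    field_simp
    simp

lemma affinePoint_injective : Function.Injective affinePoint := by
  rintro ⟨x, y⟩ ⟨x', y'⟩ h
  simp [affinePoint, mk_eq_mk_iff_cross] at h
  simp [h.1, h.2.1]

lemma sidePoint_injective : Function.Injective sidePoint := by
  intro s s' h
  simpa [sidePoint, mk_eq_mk_iff_cross] using h

lemma affinePoint_ne_sidePoint (q : ℂ × ℂ) (s : ℂ) : affinePoint q ≠ sidePoint s := by
  simp [affinePoint, sidePoint, mk_eq_mk_iff_cross]

lemma affinePoint_ne_vertexX (q : ℂ × ℂ) : affinePoint q ≠ vertexX := by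
  simp [affinePoint, vertexX, mk_eq_mk_iff_cross]

lemma sidePoint_ne_vertexX (s : ℂ) : sidePoint s ≠ vertexX := by
  simp [sidePoint, vertexX, mk_eq_mk_iff_cross]

section

variable {I J K : Finset ℂ}

lemma multiplicity_vertexX (hI : (0 : ℂ) ∉ I) (hJ : (0 : ℂ) ∉ J) (hK : (0 : ℂ) ∉ K) :
    multiplicity (slopeArrangement I J K) vertexX = J.card + 2 := by
  rw [vertexX, multiplicity_slopeArrangement hI hJ hK]
  simp; ring

open Classical in
lemma multiplicity_sidePoint (hI : (0 : ℂ) ∉ I) (hJ : (0 : ℂ) ∉ J) (hK : (0 : ℂ) ∉ K) (s : ℂ) :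
    multiplicity (slopeArrangement I J K) (sidePoint s) =
      if s = 0 then K.card + 2 else if s ∈ I then 2 else 1 := by
  rw [sidePoint, multiplicity_slopeArrangement hI hJ hK]
  by_cases hs : s = 0
  · subst hs
    have : ∀ a ∈ I, ¬ (0 : ℂ) = a := fun a ha h => hI (h ▸ ha)
    simp [Finset.filter_false_of_mem this]
    ring
  · by_cases h : s ∈ I <;> simp [hs, Finset.filter_eq, h]

open Classical in
lemma multiplicity_affinePoint (hI : (0 : ℂ) ∉ I) (hJ : (0 : ℂ) ∉ J) (hK : (0 : ℂ) ∉ K)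
    (x y : ℂ) :
    multiplicity (slopeArrangement I J K) (affinePoint (x, y)) =
      if x = 0 then (if y = 0 then I.card + 2 else if y ∈ J then 2 else 1)
      else if y = 0 then (if x ∈ K then 2 else 1)
      else (if x / y ∈ I then 1 else 0) + (if y ∈ J then 1 else 0) + (if x ∈ K then 1 else 0) := by
  rw [affinePoint, multiplicity_slopeArrangement hI hJ hK]
  by_cases hx : x = 0
  · subst hx
    have h1 : ∀ a ∈ J, ¬ (0 : ℂ) = a := fun a ha h => hJ (h ▸ ha)
    have h2 : ∀ a ∈ I, ¬ a = (0 : ℂ) := fun a ha h => hI (h ▸ ha)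
    by_cases hy : y = 0
    · subst hy
      simp [Finset.filter_eq, hJ, hK]
      ring
    · by_cases h : y ∈ J <;> simp [hy, Finset.filter_eq, hK, h, Finset.filter_false_of_mem h2]
  · by_cases hy : y = 0
    · subst hy
      by_cases h : x ∈ K <;> simp [hx, Finset.filter_eq, hJ, h]
    · have : (I.filter fun a => x = a * y) = I.filter fun a => x / y = a := by
        ext a; simp [div_eq_iff hy]
      rw [this]
      simp [hx, hy, apply_ite Finset.card, Finset.filter_eq]

end

/-! ### Weak combinatorics -/

open Classical in
/-- The affine coordinates `(c, b)` of the points off the sides of the triangle that lie on a line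
of each of the three pencils. -/
noncomputable def triplePoints (I J K : Finset ℂ) : Finset (ℂ × ℂ) :=
  (K ×ˢ J).filter fun q => q.1 / q.2 ∈ I

open Classical in
/-- The affine coordinates of the points off the sides that lie on lines of exactly two of the
three pencils. -/
noncomputable def doublePoints (I J K : Finset ℂ) : Finset (ℂ × ℂ) :=
  ((K ×ˢ J) \ triplePoints I J K) ∪
  (((I ×ˢ J).image fun q => (q.1 * q.2, q.2)) \ triplePoints I J K) ∪
  (((I ×ˢ K).image fun q => (q.2, q.2 / q.1)) \ triplePoints I J K)

section

variable {I J K : Finset ℂ}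

lemma mem_triplePoints (hJ : (0 : ℂ) ∉ J) (hK : (0 : ℂ) ∉ K) {x y : ℂ} :
    (x, y) ∈ triplePoints I J K ↔ x ≠ 0 ∧ y ≠ 0 ∧ x / y ∈ I ∧ y ∈ J ∧ x ∈ K := by
  simp only [triplePoints, Finset.mem_filter, Finset.mem_product]
  constructor
  · rintro ⟨⟨hx, hy⟩, h⟩
    exact ⟨fun h => hK (h ▸ hx), fun h => hJ (h ▸ hy), h, hy, hx⟩
  · rintro ⟨-, -, h, hy, hx⟩
    exact ⟨⟨hx, hy⟩, h⟩

lemma mem_product_iff_ne_zero (hJ : (0 : ℂ) ∉ J) (hK : (0 : ℂ) ∉ K) {x y : ℂ} :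
    (x, y) ∈ K ×ˢ J ↔ x ≠ 0 ∧ y ≠ 0 ∧ y ∈ J ∧ x ∈ K := by
  rw [Finset.mem_product]
  exact ⟨fun h => ⟨fun e => hK (e ▸ h.1), fun e => hJ (e ▸ h.2), h.2, h.1⟩,
    fun h => ⟨h.2.2.2, h.2.2.1⟩⟩

open Classical in
lemma mem_image_mul (hI : (0 : ℂ) ∉ I) (hJ : (0 : ℂ) ∉ J) {x y : ℂ} :
    (x, y) ∈ ((I ×ˢ J).image fun q => (q.1 * q.2, q.2)) ↔
      x ≠ 0 ∧ y ≠ 0 ∧ x / y ∈ I ∧ y ∈ J := by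
  rw [Finset.mem_image]
  constructor
  · rintro ⟨⟨a, b⟩, h, e⟩
    obtain ⟨ha, hb⟩ := Finset.mem_product.1 h
    obtain ⟨rfl, rfl⟩ := Prod.mk.inj e
    have h0 : a ≠ 0 := fun h => hI (h ▸ ha)
    have h0' : b ≠ 0 := fun h => hJ (h ▸ hb)
    exact ⟨mul_ne_zero h0 h0', h0', by simpa [h0'] using ha, hb⟩
  · rintro ⟨-, hy, ha, hb⟩
    exact ⟨(x / y, y), Finset.mem_product.2 ⟨ha, hb⟩, by simp [hy]⟩

open Classical in
lemma mem_image_div (hI : (0 : ℂ) ∉ I) (hK : (0 : ℂ) ∉ K) {x y : ℂ} :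
    (x, y) ∈ ((I ×ˢ K).image fun q => (q.2, q.2 / q.1)) ↔
      x ≠ 0 ∧ y ≠ 0 ∧ x / y ∈ I ∧ x ∈ K := by
  rw [Finset.mem_image]
  constructor
  · rintro ⟨⟨a, c⟩, h, e⟩
    obtain ⟨ha, hc⟩ := Finset.mem_product.1 h
    obtain ⟨rfl, rfl⟩ := Prod.mk.inj e
    have h0 : a ≠ 0 := fun h => hI (h ▸ ha)
    have h0' : c ≠ 0 := fun h => hK (h ▸ hc)
    exact ⟨h0', div_ne_zero h0' h0, by simpa [div_div_cancel₀ h0'] using ha, hc⟩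
  · rintro ⟨hx, hy, ha, hc⟩
    exact ⟨(x / y, x), Finset.mem_product.2 ⟨ha, hc⟩, by simp [div_div_cancel₀ hx]⟩

lemma mem_doublePoints (hI : (0 : ℂ) ∉ I) (hJ : (0 : ℂ) ∉ J) (hK : (0 : ℂ) ∉ K) {x y : ℂ} :
    (x, y) ∈ doublePoints I J K ↔ x ≠ 0 ∧ y ≠ 0 ∧
      ((x / y ∉ I ∧ y ∈ J ∧ x ∈ K) ∨ (x / y ∈ I ∧ y ∈ J ∧ x ∉ K) ∨
        (x / y ∈ I ∧ y ∉ J ∧ x ∈ K)) := by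
  rw [doublePoints, Finset.mem_union, Finset.mem_union, Finset.mem_sdiff, Finset.mem_sdiff,
    Finset.mem_sdiff, mem_product_iff_ne_zero hJ hK, mem_image_mul hI hJ, mem_image_div hI hK,
    mem_triplePoints hJ hK]
  by_cases h1 : x / y ∈ I <;> by_cases h2 : y ∈ J <;> by_cases h3 : x ∈ K <;>
    simp only [h1, h2, h3] <;> simp

/-- Any two of the three pencils meet in `n ^ 2` points off the sides, and a point common to two of
these three families of points lies in the third one. -/
lemma card_doublePoints {n : ℕ} (hI : (0 : ℂ) ∉ I) (hJ : (0 : ℂ) ∉ J) (hK : (0 : ℂ) ∉ K)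
    (hIn : I.card = n) (hJn : J.card = n) (hKn : K.card = n) :
    (doublePoints I J K).card = 3 * (n ^ 2 - (triplePoints I J K).card) := by
  have h2 : ∀ a ∈ J, a ≠ 0 := fun a ha h => hJ (h ▸ ha)
  have h3 : ∀ a ∈ K, a ≠ 0 := fun a ha h => hK (h ▸ ha)
  have i2 : Set.InjOn (fun q : ℂ × ℂ => (q.1 * q.2, q.2)) (I ×ˢ J : Finset _) := by
    rintro ⟨a, b⟩ h ⟨a', b'⟩ h' e
    simp only [Prod.mk.injEq] at e
    obtain ⟨e, rfl⟩ := e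
    simp [mul_right_cancel₀ (h2 _ (Finset.mem_product.1 h).2) e]
  have i3 : Set.InjOn (fun q : ℂ × ℂ => (q.2, q.2 / q.1)) (I ×ˢ K : Finset _) := by
    rintro ⟨a, c⟩ h ⟨a', c'⟩ h' e
    simp only [Prod.mk.injEq] at e
    obtain ⟨rfl, e⟩ := e
    have hc := h3 _ (Finset.mem_product.1 h).2
    simpa [div_eq_mul_inv, hc] using e
  have s1 : triplePoints I J K ⊆ K ×ˢ J := Finset.filter_subset _ _
  have s2 : triplePoints I J K ⊆ (I ×ˢ J).image fun q => (q.1 * q.2, q.2) := by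
    rintro ⟨x, y⟩ h
    obtain ⟨-, hy, hi, hj, -⟩ := (mem_triplePoints hJ hK).1 h
    exact Finset.mem_image.2 ⟨(x / y, y), Finset.mem_product.2 ⟨hi, hj⟩, by simp [hy]⟩
  have s3 : triplePoints I J K ⊆ (I ×ˢ K).image fun q => (q.2, q.2 / q.1) := by
    rintro ⟨x, y⟩ h
    obtain ⟨hx, -, hi, -, hk⟩ := (mem_triplePoints hJ hK).1 h
    exact Finset.mem_image.2 ⟨(x / y, x), Finset.mem_product.2 ⟨hi, hk⟩,
      by simp [div_div_cancel₀ hx]⟩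
  rw [doublePoints, Finset.card_union_of_disjoint, Finset.card_union_of_disjoint,
    Finset.card_sdiff_of_subset s1, Finset.card_sdiff_of_subset s2, Finset.card_sdiff_of_subset s3,
    Finset.card_image_of_injOn i2, Finset.card_image_of_injOn i3, Finset.card_product,
    Finset.card_product, Finset.card_product, hIn, hJn, hKn]
  · rw [← pow_two]; ring
  · rw [Finset.disjoint_left]
    rintro ⟨x, y⟩
    rw [Finset.mem_sdiff, Finset.mem_sdiff, mem_product_iff_ne_zero hJ hK, mem_image_mul hI hJ,
      mem_triplePoints hJ hK]
    exact fun h h' => h'.2 ⟨h.1.1, h.1.2.1, h'.1.2.2.1, h.1.2.2⟩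
  · rw [Finset.disjoint_left]
    rintro ⟨x, y⟩
    rw [Finset.mem_union, Finset.mem_sdiff, Finset.mem_sdiff, Finset.mem_sdiff,
      mem_product_iff_ne_zero hJ hK, mem_image_mul hI hJ, mem_image_div hI hK,
      mem_triplePoints hJ hK]
    rintro (h | h) h'
    · exact h'.2 ⟨h.1.1, h.1.2.1, h'.1.2.2.1, h.1.2.2⟩
    · exact h'.2 ⟨h.1.1, h.1.2.1, h.1.2.2.1, h.1.2.2.2, h'.1.2.2.2⟩

/-- The points of a given multiplicity, counted chart by chart. -/
lemma t_eq_of_charts {A : Arrangement} {i : ℕ} {F : Finset (ℂ × ℂ)} {G : Finset ℂ}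
    (hF : ∀ x y, multiplicity A (affinePoint (x, y)) = i ↔ (x, y) ∈ F)
    (hG : ∀ s, multiplicity A (sidePoint s) = i ↔ s ∈ G) :
    t A i = F.card + G.card + if multiplicity A vertexX = i then 1 else 0 := by
  classical
  have h : {p : Point | multiplicity A p = i} = (F.image affinePoint ∪ G.image sidePoint ∪
      if multiplicity A vertexX = i then {vertexX} else ∅ : Finset Point) := by
    ext p
    rw [Finset.mem_coe, Finset.mem_union, Finset.mem_union, Set.mem_ofPred_eq]
    obtain ⟨⟨x, y⟩, rfl⟩ | ⟨s, rfl⟩ | rfl := point_cases p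
    · rw [hF, affinePoint_injective.mem_finset_image]
      split_ifs <;>
        simp [affinePoint_ne_vertexX, (affinePoint_ne_sidePoint _ _).symm]
    · rw [hG, sidePoint_injective.mem_finset_image]
      split_ifs <;>
        simp [sidePoint_ne_vertexX, affinePoint_ne_sidePoint]
    · split_ifs with h <;>
        simp [h, sidePoint_ne_vertexX, affinePoint_ne_vertexX]
  rw [t, h, Set.ncard_coe_finset, Finset.card_union_of_disjoint, Finset.card_union_of_disjoint,
    Finset.card_image_of_injective _ affinePoint_injective,
    Finset.card_image_of_injective _ sidePoint_injective]
  · split_ifs <;> simp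
  · rw [Finset.disjoint_left]
    rintro p hp hp'
    obtain ⟨q, -, rfl⟩ := Finset.mem_image.1 hp
    obtain ⟨s, -, h⟩ := Finset.mem_image.1 hp'
    exact affinePoint_ne_sidePoint _ _ h.symm
  · split_ifs
    · simp [sidePoint_ne_vertexX, affinePoint_ne_vertexX]
    · simp

lemma t_two_slopeArrangement {n : ℕ} (hI : (0 : ℂ) ∉ I) (hJ : (0 : ℂ) ∉ J)
    (hK : (0 : ℂ) ∉ K) (hIn : I.card = n) (hJn : J.card = n) (hKn : K.card = n) (hn : 1 ≤ n) :
    t (slopeArrangement I J K) 2 = 3 * n + 3 * (n ^ 2 - (triplePoints I J K).card) := by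
  classical
  rw [t_eq_of_charts (F := J.image (fun b => (0, b)) ∪ K.image (fun c => (c, 0)) ∪
    doublePoints I J K) (G := I)]
  · rw [multiplicity_vertexX hI hJ hK, if_neg (by omega), Finset.card_union_of_disjoint,
      Finset.card_union_of_disjoint, Finset.card_image_of_injective, Finset.card_image_of_injective,
      card_doublePoints hI hJ hK hIn hJn hKn, hIn, hJn, hKn]
    · ring
    · exact fun a b h => (Prod.mk.inj h).1
    · exact fun a b h => (Prod.mk.inj h).2
    · rw [Finset.disjoint_left]
      simp only [Finset.mem_image, not_exists, not_and]
      rintro _ ⟨b, hb, rfl⟩ c hc h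
      exact hJ ((Prod.mk.inj h).2 ▸ hb)
    · rw [Finset.disjoint_left]
      simp only [Finset.mem_union, Finset.mem_image]
      rintro _ (⟨b, hb, rfl⟩ | ⟨b, hb, rfl⟩) <;> simp [mem_doublePoints hI hJ hK]
  · intro x y
    rw [multiplicity_affinePoint hI hJ hK]
    simp only [Finset.mem_union, Finset.mem_image, Prod.mk.injEq, mem_doublePoints hI hJ hK]
    by_cases hx : x = 0
    · subst hx
      by_cases hy : y = 0
      · subst hy
        have : I ≠ ∅ := fun h => by simp [h] at hIn; omega
        simp [this, hJ, hK]
      · simp [hy, Ne.symm hy]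
    · by_cases hy : y = 0
      · subst hy
        simp [hx, Ne.symm hx]
      · simp only [hx, hy, Ne.symm hx, Ne.symm hy, if_false]
        split_ifs <;> simp_all
  · intro s
    rw [multiplicity_sidePoint hI hJ hK]
    by_cases hs : s = 0
    · subst hs
      have : K ≠ ∅ := fun h => by simp [h] at hKn; omega
      simp [hI, this]
    · simp [hs]

lemma t_three_slopeArrangement {n : ℕ} (hI : (0 : ℂ) ∉ I) (hJ : (0 : ℂ) ∉ J)
    (hK : (0 : ℂ) ∉ K) (hIn : I.card = n) (hJn : J.card = n) (hKn : K.card = n) (hn : 2 ≤ n) :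
    t (slopeArrangement I J K) 3 = (triplePoints I J K).card := by
  classical
  rw [t_eq_of_charts (F := triplePoints I J K) (G := ∅)]
  · rw [multiplicity_vertexX hI hJ hK, if_neg (by omega)]
    simp
  · intro x y
    rw [multiplicity_affinePoint hI hJ hK, mem_triplePoints hJ hK]
    split_ifs <;> simp_all
    omega
  · intro s
    rw [multiplicity_sidePoint hI hJ hK]
    split_ifs <;> simp_all
    omega

lemma t_add_two_slopeArrangement {n : ℕ} (hI : (0 : ℂ) ∉ I) (hJ : (0 : ℂ) ∉ J)
    (hK : (0 : ℂ) ∉ K) (hIn : I.card = n) (hJn : J.card = n) (hKn : K.card = n) (hn : 2 ≤ n) :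
    t (slopeArrangement I J K) (n + 2) = 3 := by
  classical
  rw [t_eq_of_charts (F := {(0, 0)}) (G := {0})]
  · rw [multiplicity_vertexX hI hJ hK, if_pos (by omega)]
    simp
  · intro x y
    rw [multiplicity_affinePoint hI hJ hK, hIn, Finset.mem_singleton, Prod.mk.injEq]
    by_cases hx : x = 0 <;> by_cases hy : y = 0 <;> simp only [hx, hy, if_true, if_false]
    · simp
    all_goals split_ifs <;> simp <;> omega
  · intro s
    rw [multiplicity_sidePoint hI hJ hK, hKn, Finset.mem_singleton]
    by_cases hs : s = 0
    · simp [hs]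
    · simp only [hs, if_false, iff_false]
      split_ifs <;> omega

lemma t_slopeArrangement_eq_zero {n : ℕ} (hI : (0 : ℂ) ∉ I) (hJ : (0 : ℂ) ∉ J)
    (hK : (0 : ℂ) ∉ K) (hIn : I.card = n) (hJn : J.card = n) (hKn : K.card = n)
    {i : ℕ} (hi : 2 ≤ i) (h2 : i ≠ 2) (h3 : i ≠ 3)
    (hn2 : i ≠ n + 2) : t (slopeArrangement I J K) i = 0 := by
  classical
  rw [t_eq_of_charts (F := ∅) (G := ∅)]
  · rw [multiplicity_vertexX hI hJ hK, if_neg (by omega)]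
    simp
  · intro x y
    rw [multiplicity_affinePoint hI hJ hK]
    simp only [Finset.notMem_empty, iff_false]
    split_ifs <;> omega
  · intro s
    rw [multiplicity_sidePoint hI hJ hK]
    simp only [Finset.notMem_empty, iff_false]
    split_ifs <;> omega

lemma isTriangular_slopeArrangement {n : ℕ} (hI : (0 : ℂ) ∉ I) (hJ : (0 : ℂ) ∉ J)
    (hK : (0 : ℂ) ∉ K) (hIn : I.card = n) (hJn : J.card = n) (hKn : K.card = n) :
    IsTriangular (slopeArrangement I J K) (n + 1) (n + 1) (n + 1) := by
  refine ⟨affinePoint (0, 0), vertexX, sidePoint 0, ?_, ?_, ?_, ?_, ?_, ?_⟩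
  · have h : LinearIndependent ℂ ![(![0, 0, 1] : Fin 3 → ℂ), ![1, 0, 0], ![0, 1, 0]] := by
      rw [Fintype.linearIndependent_iff]
      intro g hg
      have h0 := congrFun hg 0
      have h1 := congrFun hg 1
      have h2 := congrFun hg 2
      simp [Fin.sum_univ_three] at h0 h1 h2
      intro i
      fin_cases i <;> simp [h0, h1, h2]
    have e : ![affinePoint (0, 0), vertexX, sidePoint 0] = fun i => Projectivization.mk ℂ
        (![(![0, 0, 1] : Fin 3 → ℂ), ![1, 0, 0], ![0, 1, 0]] i) (h.ne_zero i) := by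
      funext i
      fin_cases i <;> rfl
    rw [e]
    exact Projectivization.Independent.mk _ _ h
  · intro l hl
    obtain (rfl | rfl | rfl) | ⟨a, -, rfl⟩ | ⟨a, -, rfl⟩ | ⟨a, -, rfl⟩ :=
      mem_slopeArrangement.1 hl <;>
    simp [Passes, lineX, lineY, lineZ, lineXY, lineYZ, lineXZ, affinePoint, vertexX, sidePoint,
      Projectivization.orthogonal_mk]
  · intro l h
    rw [mem_slopeArrangement]
    left
    induction l using Projectivization.ind with | h v hv =>
    simp only [Passes, affinePoint, vertexX, sidePoint, Projectivization.orthogonal_mk,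
      dotProduct, Fin.sum_univ_three] at h
    simp [lineX, lineY, lineZ, mk_eq_mk_iff_cross] at h ⊢
    tauto
  · simp [multiplicity_affinePoint hI hJ hK, hIn]
  · simp [multiplicity_vertexX hI hJ hK, hJn]
  · simp [multiplicity_sidePoint hI hJ hK, hKn]

end

/-! ### Defining linear forms and tangent fields -/

/-- The linear form with coefficients `v`; unlike `linearForm`, it does not involve the choice of a
representative of a projective class. -/
noncomputable def linearPoly (v : Fin 3 → ℂ) : Poly := ∑ i, C (v i) * X i

lemma linearForm_mk (v : Fin 3 → ℂ) (hv : v ≠ 0) :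
    ∃ u : ℂˣ, linearForm (Projectivization.mk ℂ v hv) = C (u : ℂ) * linearPoly v ∧
      (Projectivization.mk ℂ v hv).rep = u • v := by
  obtain ⟨u, hu⟩ := Projectivization.exists_smul_eq_mk_rep ℂ v hv
  refine ⟨u, ?_, hu.symm⟩
  simp only [linearForm, linearPoly, ← hu, Finset.mul_sum]
  refine Finset.sum_congr rfl fun i _ => ?_
  simp [Units.smul_def, mul_assoc]

lemma associated_linearForm_mk (v : Fin 3 → ℂ) (hv : v ≠ 0) :
    Associated (linearForm (Projectivization.mk ℂ v hv)) (linearPoly v) := by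
  obtain ⟨u, hu, -⟩ := linearForm_mk v hv
  rw [hu]
  exact (associated_isUnit_mul_left_iff ((u.isUnit).map C)).2 (Associated.refl _)

lemma isHomogeneous_linearForm (l : Line) : (linearForm l).IsHomogeneous 1 :=
  IsHomogeneous.sum _ _ _ fun i _ => by
    simpa using (isHomogeneous_C _ (l.rep i)).mul (isHomogeneous_X ℂ i)

lemma coeff_linearForm (l : Line) (i : Fin 3) :
    coeff (Finsupp.single i 1) (linearForm l) = l.rep i := by
  simp [linearForm, coeff_sum, coeff_C_mul, coeff_X, Finsupp.single_left_inj]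

lemma prime_linearForm (l : Line) : Prime (linearForm l) := by
  obtain ⟨i, hi⟩ : ∃ i, l.rep i ≠ 0 := Function.ne_iff.1 l.rep_nonzero
  have h0 : linearForm l ≠ 0 := fun h => hi (by rw [← coeff_linearForm, h, coeff_zero])
  refine Irreducible.prime (irreducible_of_totalDegree_eq_one
    ((isHomogeneous_linearForm l).totalDegree h0) fun x hx => ?_)
  refine isUnit_iff_ne_zero.2 fun h => hi ?_
  have := hx (Finsupp.single i 1)
  rwa [h, zero_dvd_iff, coeff_linearForm] at this

lemma eval_linearForm (l : Line) (v : Fin 3 → ℂ) : eval v (linearForm l) = l.rep ⬝ᵥ v := by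
  simp [linearForm, dotProduct]

/-- The form of `m` vanishes at the points `l × w` of `l`, so the triple products `(m, l, w)` are
zero for all `w`. -/
lemma eq_of_linearForm_dvd {l m : Line} (h : linearForm l ∣ linearForm m) : l = m := by
  have key : ∀ v, l.rep ⬝ᵥ v = 0 → m.rep ⬝ᵥ v = 0 := fun v hv => by
    rw [← eval_linearForm] at hv ⊢
    obtain ⟨g, hg⟩ := h
    rw [hg, map_mul, hv, zero_mul]
  have hc : crossProduct m.rep l.rep = 0 := by
    refine dotProduct_eq_zero _ fun w => ?_
    rw [dotProduct_comm, triple_product_permutation]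
    exact key _ (dot_self_cross _ _)
  rw [← l.mk_rep, ← m.mk_rep, eq_comm]
  exact (Projectivization.mk_eq_mk_iff_crossProduct_eq_zero _ _).2 hc

lemma isRelPrime_linearForm {l m : Line} (h : l ≠ m) : IsRelPrime (linearForm l) (linearForm m) :=
  ((prime_linearForm l).irreducible.isRelPrime_iff_not_dvd).2 fun h' => h (eq_of_linearForm_dvd h')

lemma mem_tangentModule {A : Arrangement} {θ : Fin 3 → Poly} :
    θ ∈ tangentModule A ↔ ∑ i, θ i * pderiv i (definingPoly A) = 0 := by
  simp [tangentModule, Fintype.linearCombination_apply]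

lemma mem_tangentModule_of_associated {A : Arrangement} {F : Poly}
    (h : Associated F (definingPoly A)) {θ : Fin 3 → Poly} :
    θ ∈ tangentModule A ↔ ∑ i, θ i * pderiv i F = 0 := by
  obtain ⟨u, hu⟩ := h
  obtain ⟨c, hc, hc'⟩ := MvPolynomial.isUnit_iff_eq_C_of_isReduced.1 u.isUnit
  have h0 : C (σ := Fin 3) c ≠ 0 := by simpa using hc.ne_zero
  rw [mem_tangentModule, ← hu, hc']
  simp only [Derivation.leibniz, pderiv_C, mul_zero, zero_add, smul_eq_mul, mul_left_comm _ (C c),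
    ← Finset.mul_sum, mul_eq_zero, h0, false_or]

/-- A tangent field preserves the ideal of every line of the arrangement. -/
lemma linearForm_dvd_of_mem_tangentModule {A : Arrangement} {θ : Fin 3 → Poly}
    (hθ : θ ∈ tangentModule A) {l : Line} (hl : l ∈ A) :
    linearForm l ∣ ∑ i, θ i * C (l.rep i) := by
  classical
  set G := ∏ m ∈ A.erase l, linearForm m with hG
  have hd : definingPoly A = linearForm l * G := (Finset.mul_prod_erase A _ hl).symm
  have hlG : ¬ linearForm l ∣ G := fun h => by
    obtain ⟨m, hm, h⟩ := (prime_linearForm l).exists_mem_finset_dvd h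
    exact Finset.ne_of_mem_erase hm (eq_of_linearForm_dvd h).symm
  have hp : ∀ i, pderiv i (linearForm l) = C (l.rep i) := fun i => by
    simp [linearForm, pderiv_X, Pi.single_apply]
  rw [mem_tangentModule, hd] at hθ
  simp only [Derivation.leibniz, hp, smul_eq_mul] at hθ
  refine ((prime_linearForm l).dvd_or_dvd (b := G) ⟨-∑ i, θ i * pderiv i G, ?_⟩).resolve_right hlG
  rw [Fin.sum_univ_three] at hθ ⊢
  rw [Fin.sum_univ_three]
  linear_combination hθ

lemma linearPoly_dvd_of_mem_tangentModule {A : Arrangement} {θ : Fin 3 → Poly}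
    (hθ : θ ∈ tangentModule A) {v : Fin 3 → ℂ} (hv : v ≠ 0)
    (hl : Projectivization.mk ℂ v hv ∈ A) : linearPoly v ∣ ∑ i, θ i * C (v i) := by
  have h := linearForm_dvd_of_mem_tangentModule hθ hl
  obtain ⟨u, hu, hu'⟩ := linearForm_mk v hv
  rw [(associated_linearForm_mk v hv).dvd_iff_dvd_left, hu'] at h
  have e : ∑ i, θ i * C ((u • v) i) = C (u : ℂ) * ∑ i, θ i * C (v i) := by
    rw [Finset.mul_sum]
    refine Finset.sum_congr rfl fun i _ => ?_
    simp [Units.smul_def]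
    ring
  rw [e] at h
  exact (((u.isUnit).map C).dvd_mul_left).1 h

/-! ### The binary forms of the three pencils -/

/-- The binary form `∏ (x_i - a x_j)`, `a ∈ I`. -/
noncomputable def pencilPoly (i j : Fin 3) (I : Finset ℂ) : Poly := ∏ a ∈ I, (X i - C a * X j)

lemma isHomogeneous_pencilPoly (i j : Fin 3) (I : Finset ℂ) :
    (pencilPoly i j I).IsHomogeneous I.card := by
  have := IsHomogeneous.prod I (fun a : ℂ => (X i - C a * X j : Poly)) (fun _ => 1) fun a _ =>
    (isHomogeneous_X ℂ i).sub (by simpa using (isHomogeneous_C _ a).mul (isHomogeneous_X ℂ j))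
  simpa [pencilPoly] using this

lemma pderiv_pencilPoly {i j k : Fin 3} (hi : i ≠ k) (hj : j ≠ k) (I : Finset ℂ) :
    pderiv k (pencilPoly i j I) = 0 := by
  classical
  induction I using Finset.induction_on with
  | empty => simp [pencilPoly]
  | insert a s ha ih =>
    rw [pencilPoly, Finset.prod_insert ha, ← pencilPoly, Derivation.leibniz, ih]
    simp [pderiv_X_of_ne hi, pderiv_X_of_ne hj]

lemma linearPoly_XY (a : ℂ) : linearPoly ![1, -a, 0] = X 0 - C a * X 1 := by
  simp [linearPoly, Fin.sum_univ_three, sub_eq_add_neg]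

lemma linearPoly_YZ (a : ℂ) : linearPoly ![0, 1, -a] = X 1 - C a * X 2 := by
  simp [linearPoly, Fin.sum_univ_three, sub_eq_add_neg]

lemma linearPoly_XZ (a : ℂ) : linearPoly ![1, 0, -a] = X 0 - C a * X 2 := by
  simp [linearPoly, Fin.sum_univ_three, sub_eq_add_neg]

lemma associated_lineXY (a : ℂ) : Associated (linearForm (lineXY a)) (X 0 - C a * X 1) :=
  linearPoly_XY a ▸ associated_linearForm_mk _ _

lemma associated_lineYZ (a : ℂ) : Associated (linearForm (lineYZ a)) (X 1 - C a * X 2) :=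
  linearPoly_YZ a ▸ associated_linearForm_mk _ _

lemma associated_lineXZ (a : ℂ) : Associated (linearForm (lineXZ a)) (X 0 - C a * X 2) :=
  linearPoly_XZ a ▸ associated_linearForm_mk _ _

lemma associated_pencilPoly {i j : Fin 3} {l : ℂ → Line} (I : Finset ℂ)
    (h : ∀ a, Associated (linearForm (l a)) (X i - C a * X j)) :
    Associated (∏ a ∈ I, linearForm (l a)) (pencilPoly i j I) :=
  Associated.prod _ _ _ fun a _ => h a

/-- The binary forms of the three pencils of a slope arrangement. -/
noncomputable def pencilForms (I J K : Finset ℂ) : Fin 3 → Poly :=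
  ![pencilPoly 0 1 I, pencilPoly 1 2 J, pencilPoly 0 2 K]

lemma pencilForms_zero (I J K : Finset ℂ) : pencilForms I J K 0 = pencilPoly 0 1 I := rfl

lemma pencilForms_one (I J K : Finset ℂ) : pencilForms I J K 1 = pencilPoly 1 2 J := rfl

lemma pencilForms_two (I J K : Finset ℂ) : pencilForms I J K 2 = pencilPoly 0 2 K := rfl

lemma associated_definingPoly {I J K : Finset ℂ}
    (hI : (0 : ℂ) ∉ I) (hJ : (0 : ℂ) ∉ J) (hK : (0 : ℂ) ∉ K) :
    Associated (X 0 * X 1 * X 2 * pencilPoly 0 1 I * pencilPoly 1 2 J * pencilPoly 0 2 K)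
      (definingPoly (slopeArrangement I J K)) := by
  rw [definingPoly, prod_slopeArrangement hI hJ hK]
  have hX : linearPoly ![1, 0, 0] = X 0 := by simp [linearPoly, Fin.sum_univ_three]
  have hY : linearPoly ![0, 1, 0] = X 1 := by simp [linearPoly, Fin.sum_univ_three]
  have hZ : linearPoly ![0, 0, 1] = X 2 := by simp [linearPoly, Fin.sum_univ_three]
  have aX : Associated (linearForm lineX) (X 0) := hX ▸ associated_linearForm_mk _ _
  have aY : Associated (linearForm lineY) (X 1) := hY ▸ associated_linearForm_mk _ _
  have aZ : Associated (linearForm lineZ) (X 2) := hZ ▸ associated_linearForm_mk _ _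
  exact (((((aX.mul_mul aY).mul_mul aZ).mul_mul
    (associated_pencilPoly I associated_lineXY)).mul_mul
    (associated_pencilPoly J associated_lineYZ)).mul_mul
    (associated_pencilPoly K associated_lineXZ)).symm

/-- A polynomial that vanishes on every line of a pencil is divisible by the pencil form. -/
lemma pencilPoly_dvd {i j : Fin 3} {l : ℂ → Line} {I : Finset ℂ} (hl : Function.Injective l)
    (h : ∀ a, Associated (linearForm (l a)) (X i - C a * X j)) {g : Poly}
    (hg : ∀ a ∈ I, (X i - C a * X j) ∣ g) : pencilPoly i j I ∣ g := by
  rw [← (associated_pencilPoly I h).dvd_iff_dvd_left]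
  refine Finset.prod_dvd_of_isRelPrime (fun a _ b _ hab => isRelPrime_linearForm (hl.ne hab))
    fun a ha => ?_
  rw [(h a).dvd_iff_dvd_left]
  exact hg a ha

lemma isRelPrime_pencilPoly {i j i' j' : Fin 3} {l l' : ℂ → Line} {I I' : Finset ℂ}
    (h : ∀ a, Associated (linearForm (l a)) (X i - C a * X j))
    (h' : ∀ a, Associated (linearForm (l' a)) (X i' - C a * X j'))
    (hne : ∀ a ∈ I, ∀ b ∈ I', l a ≠ l' b) :
    IsRelPrime (pencilPoly i j I) (pencilPoly i' j' I') := by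
  refine IsRelPrime.prod_left fun a ha => IsRelPrime.prod_right fun b hb => ?_
  have := isRelPrime_linearForm (hne a ha b hb)
  intro d hd hd'
  exact this ((h a).symm.dvd_iff_dvd_right.1 hd) ((h' b).symm.dvd_iff_dvd_right.1 hd')

lemma pencilPoly_ne_zero {i j : Fin 3} {l : ℂ → Line} (I : Finset ℂ)
    (h : ∀ a, Associated (linearForm (l a)) (X i - C a * X j)) : pencilPoly i j I ≠ 0 :=
  Finset.prod_ne_zero_iff.2 fun a _ => (h a).ne_zero_iff.1 (prime_linearForm _).ne_zero

/-! ### Tangent fields as syzygies -/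

/-- The module of syzygies of three polynomials. -/
noncomputable def syzygies (G : Fin 3 → Poly) : Submodule Poly (Fin 3 → Poly) :=
  LinearMap.ker (Fintype.linearCombination Poly G)

lemma mem_syzygies {G c : Fin 3 → Poly} :
    c ∈ syzygies G ↔ c 0 * G 0 + c 1 * G 1 + c 2 * G 2 = 0 := by
  simp [syzygies, Fintype.linearCombination_apply, Fin.sum_univ_three]

/-- The polynomial `p y P_y + q z Q_z + r x R_x` for `G = (P, Q, R)` and `c = (p, q, r)`. -/
noncomputable def radialPart (G c : Fin 3 → Poly) : Poly :=
  c 0 * (X 1 * pderiv 1 (G 0)) + c 1 * (X 2 * pderiv 2 (G 1)) + c 2 * (X 0 * pderiv 0 (G 2))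

/-- The three quotients `g = (θ_x / x, θ_y / y, θ_z / z)` of the tangent field `θ` attached to a
syzygy `c = (p, q, r)` of `G = (P, Q, R)`: they are the solution of `g₀ - g₁ = p P`,
`g₁ - g₂ = q Q`, `g₂ - g₀ = r R` and `(n + 1) (g₀ + g₁ + g₂) = p y P_y + q z Q_z + r x R_x`. -/
noncomputable def fieldQuotients (n : ℕ) (G c : Fin 3 → Poly) : Fin 3 → Poly :=
  ![C (1 / 3 : ℂ) * (C (1 / ((n : ℂ) + 1)) * radialPart G c + c 0 * G 0 - c 2 * G 2),
    C (1 / 3 : ℂ) * (C (1 / ((n : ℂ) + 1)) * radialPart G c + c 1 * G 1 - c 0 * G 0),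
    C (1 / 3 : ℂ) * (C (1 / ((n : ℂ) + 1)) * radialPart G c + c 2 * G 2 - c 1 * G 1)]

/-- The linear map that sends a syzygy of the pencil forms to a tangent field. -/
noncomputable def syzygyField (n : ℕ) (G : Fin 3 → Poly) :
    (Fin 3 → Poly) →ₗ[Poly] (Fin 3 → Poly) where
  toFun c i := X i * fieldQuotients n G c i
  map_add' c c' := by
    funext i
    fin_cases i <;> simp [fieldQuotients, radialPart] <;> ring
  map_smul' s c := by
    funext i
    fin_cases i <;> simp [fieldQuotients, radialPart] <;> ring

lemma succ_mul_sum_fieldQuotients (n : ℕ) (G c : Fin 3 → Poly) :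
    (n + 1 : Poly) * (fieldQuotients n G c 0 + fieldQuotients n G c 1 + fieldQuotients n G c 2) =
      radialPart G c := by
  have h3 : (C (1 / 3 : ℂ) : Poly) * 3 = 1 := by
    rw [← map_ofNat C 3, ← map_mul]; norm_num
  have hn : (C (1 / ((n : ℂ) + 1)) : Poly) * (n + 1) = 1 := by
    have : (n : ℂ) + 1 ≠ 0 := by exact_mod_cast n.succ_ne_zero
    rw [← map_natCast C n, ← map_one C, ← map_add, ← map_mul, one_div_mul_cancel this]
  simp only [fieldQuotients, Matrix.cons_val]
  linear_combination (radialPart G c) * hn + (radialPart G c) * C (1 / ((n : ℂ) + 1)) * (n + 1) * h3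

lemma fieldQuotients_sub (n : ℕ) {G c : Fin 3 → Poly} (hc : c ∈ syzygies G) :
    fieldQuotients n G c 0 - fieldQuotients n G c 1 = c 0 * G 0 ∧
    fieldQuotients n G c 1 - fieldQuotients n G c 2 = c 1 * G 1 ∧
    fieldQuotients n G c 2 - fieldQuotients n G c 0 = c 2 * G 2 := by
  have h3 : (C (1 / 3 : ℂ) : Poly) * 3 = 1 := by
    rw [← map_ofNat C 3, ← map_mul]; norm_num
  rw [mem_syzygies] at hc
  simp only [fieldQuotients, Matrix.cons_val]
  refine ⟨?_, ?_, ?_⟩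
  · linear_combination (c 0 * G 0) * h3 - C (1 / 3 : ℂ) * hc
  · linear_combination (c 1 * G 1) * h3 - C (1 / 3 : ℂ) * hc
  · linear_combination (c 2 * G 2) * h3 - C (1 / 3 : ℂ) * hc

lemma fieldQuotients_unique {n : ℕ} {G c g : Fin 3 → Poly} (h0 : g 0 - g 1 = c 0 * G 0)
    (h1 : g 1 - g 2 = c 1 * G 1) (h2 : g 2 - g 0 = c 2 * G 2)
    (h : (n + 1 : Poly) * (g 0 + g 1 + g 2) = radialPart G c) : fieldQuotients n G c = g := by
  have h3 : (C (1 / 3 : ℂ) : Poly) * 3 = 1 := by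
    rw [← map_ofNat C 3, ← map_mul]; norm_num
  have hn : (C (1 / ((n : ℂ) + 1)) : Poly) * (n + 1) = 1 := by
    have : (n : ℂ) + 1 ≠ 0 := by exact_mod_cast n.succ_ne_zero
    rw [← map_natCast C n, ← map_one C, ← map_add, ← map_mul, one_div_mul_cancel this]
  have hr : C (1 / ((n : ℂ) + 1)) * radialPart G c = g 0 + g 1 + g 2 := by
    rw [← h]
    linear_combination (g 0 + g 1 + g 2) * hn
  funext i
  fin_cases i
  · change C (1 / 3 : ℂ) * (C (1 / ((n : ℂ) + 1)) * radialPart G c + c 0 * G 0 - c 2 * G 2) = g 0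
    rw [hr, ← h0, ← h2]
    linear_combination g 0 * h3
  · change C (1 / 3 : ℂ) * (C (1 / ((n : ℂ) + 1)) * radialPart G c + c 1 * G 1 - c 0 * G 0) = g 1
    rw [hr, ← h0, ← h1]
    linear_combination g 1 * h3
  · change C (1 / 3 : ℂ) * (C (1 / ((n : ℂ) + 1)) * radialPart G c + c 2 * G 2 - c 1 * G 1) = g 2
    rw [hr, ← h1, ← h2]
    linear_combination g 2 * h3

/-- How a field `(x g₀, y g₁, z g₂)` with `g₀ - g₁ = p P`, `g₁ - g₂ = q Q`, `g₂ - g₀ = r R` acts on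
`x y z P Q R`. By Euler's identity it multiplies `P` by `n g₀ - p y P_y`, and likewise `Q`
and `R`. -/
lemma sum_mul_pderiv_of_sub_eq {n : ℕ} {G c g : Fin 3 → Poly} (hG : ∀ i, (G i).IsHomogeneous n)
    (d0 : pderiv 2 (G 0) = 0) (d1 : pderiv 0 (G 1) = 0) (d2 : pderiv 1 (G 2) = 0)
    (h0 : g 0 - g 1 = c 0 * G 0) (h1 : g 1 - g 2 = c 1 * G 1) (h2 : g 2 - g 0 = c 2 * G 2) :
    ∑ i, X i * g i * pderiv i (X 0 * X 1 * X 2 * G 0 * G 1 * G 2) =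
      (X 0 * X 1 * X 2 * G 0 * G 1 * G 2) *
        ((n + 1 : Poly) * (g 0 + g 1 + g 2) - radialPart G c) := by
  have e0 := (hG 0).sum_X_mul_pderiv
  have e1 := (hG 1).sum_X_mul_pderiv
  have e2 := (hG 2).sum_X_mul_pderiv
  simp only [Fin.sum_univ_three, d0, d1, d2, nsmul_eq_mul, mul_zero, add_zero, zero_add]
    at e0 e1 e2
  simp only [Fin.sum_univ_three, Derivation.leibniz, smul_eq_mul, d0, d1, d2, pderiv_X,
    Pi.single_apply, radialPart]
  simp only [Fin.reduceEq, if_true, if_false, mul_zero, add_zero, zero_add, mul_one]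
  linear_combination X 0 * X 1 * X 2 * (G 1 * G 2 * g 0 * e0 + G 0 * G 2 * g 1 * e1 +
    G 0 * G 1 * g 2 * e2 - G 1 * G 2 * X 1 * pderiv 1 (G 0) * h0 -
    G 0 * G 2 * X 2 * pderiv 2 (G 1) * h1 - G 0 * G 1 * X 0 * pderiv 0 (G 2) * h2)

section

variable {I J K : Finset ℂ} {n : ℕ}

lemma isHomogeneous_pencilForms (hIn : I.card = n) (hJn : J.card = n) (hKn : K.card = n)
    (i : Fin 3) : (pencilForms I J K i).IsHomogeneous n := by
  fin_cases i
  · exact hIn ▸ isHomogeneous_pencilPoly 0 1 I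
  · exact hJn ▸ isHomogeneous_pencilPoly 1 2 J
  · exact hKn ▸ isHomogeneous_pencilPoly 0 2 K

lemma sum_syzygyField_mul_pderiv (hIn : I.card = n) (hJn : J.card = n) (hKn : K.card = n)
    {c g : Fin 3 → Poly} (h0 : g 0 - g 1 = c 0 * pencilForms I J K 0)
    (h1 : g 1 - g 2 = c 1 * pencilForms I J K 1) (h2 : g 2 - g 0 = c 2 * pencilForms I J K 2) :
    ∑ i, X i * g i * pderiv i
      (X 0 * X 1 * X 2 * pencilPoly 0 1 I * pencilPoly 1 2 J * pencilPoly 0 2 K) =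
      (X 0 * X 1 * X 2 * pencilPoly 0 1 I * pencilPoly 1 2 J * pencilPoly 0 2 K) *
        ((n + 1 : Poly) * (g 0 + g 1 + g 2) - radialPart (pencilForms I J K) c) := by
  simp only [← pencilForms_zero I J K, ← pencilForms_one I J K, ← pencilForms_two I J K]
  refine sum_mul_pderiv_of_sub_eq (isHomogeneous_pencilForms hIn hJn hKn) ?_ ?_ ?_ h0 h1 h2
  · exact pderiv_pencilPoly (by decide) (by decide) I
  · exact pderiv_pencilPoly (by decide) (by decide) J
  · exact pderiv_pencilPoly (by decide) (by decide) K

lemma syzygyField_mem (hI : (0 : ℂ) ∉ I) (hJ : (0 : ℂ) ∉ J) (hK : (0 : ℂ) ∉ K)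
    (hIn : I.card = n) (hJn : J.card = n) (hKn : K.card = n) {c : Fin 3 → Poly}
    (hc : c ∈ syzygies (pencilForms I J K)) :
    syzygyField n (pencilForms I J K) c ∈ tangentModule (slopeArrangement I J K) := by
  obtain ⟨h0, h1, h2⟩ := fieldQuotients_sub n hc
  rw [mem_tangentModule_of_associated (associated_definingPoly hI hJ hK)]
  refine (sum_syzygyField_mul_pderiv hIn hJn hKn h0 h1 h2).trans ?_
  rw [succ_mul_sum_fieldQuotients, sub_self, mul_zero]

lemma pencilForms_ne_zero (i : Fin 3) : pencilForms I J K i ≠ 0 := by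
  fin_cases i
  · exact pencilPoly_ne_zero I associated_lineXY
  · exact pencilPoly_ne_zero J associated_lineYZ
  · exact pencilPoly_ne_zero K associated_lineXZ

/-- If the line `x_i = a x_j` is preserved by the field with coefficients `x_i u` and `x_j v`, then
`u - v` vanishes on it. -/
lemma sub_dvd_sub_of_dvd {i j : Fin 3} (hij : i ≠ j) {a : ℂ} (ha : a ≠ 0)
    {l : ℂ → Line} (h : ∀ a, Associated (linearForm (l a)) (X i - C a * X j)) {u v : Poly}
    (hd : (X i - C a * X j) ∣ X i * u - C a * (X j * v)) : (X i - C a * X j) ∣ u - v := by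
  have hp : Prime (X i - C a * X j : Poly) := (h a).prime (prime_linearForm _)
  have h1 : (X i - C a * X j : Poly) ∣ C a * X j * (u - v) := by
    have := hd.sub (dvd_mul_right (X i - C a * X j : Poly) u)
    convert this using 1
    ring
  refine (hp.dvd_or_dvd h1).resolve_left fun ⟨e, he⟩ => ?_
  -- The point with `x_i = a`, `x_j = 1` lies on the line, but `a x_j` does not vanish there.
  have := congrArg (eval (Pi.single i a + Pi.single j 1)) he
  simp [hij, hij.symm, ha] at this

/-- Every tangent field of a slope arrangement comes from a syzygy of its pencil forms: each line of
the arrangement is preserved, so each of `x`, `y`, `z` divides the corresponding coefficient and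
each pencil form divides a difference of the quotients. -/
lemma exists_syzygyField_eq (hI : (0 : ℂ) ∉ I) (hJ : (0 : ℂ) ∉ J) (hK : (0 : ℂ) ∉ K)
    (hIn : I.card = n) (hJn : J.card = n) (hKn : K.card = n) {θ : Fin 3 → Poly}
    (hθ : θ ∈ tangentModule (slopeArrangement I J K)) :
    ∃ c ∈ syzygies (pencilForms I J K), syzygyField n (pencilForms I J K) c = θ := by
  have hx : (X 0 : Poly) ∣ θ 0 := by
    have := linearPoly_dvd_of_mem_tangentModule hθ (v := ![1, 0, 0])
      (fun h => by simpa using congrFun h 0) (mem_slopeArrangement.2 (Or.inl (Or.inl rfl)))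
    simpa [linearPoly, Fin.sum_univ_three] using this
  have hy : (X 1 : Poly) ∣ θ 1 := by
    have := linearPoly_dvd_of_mem_tangentModule hθ (v := ![0, 1, 0])
      (fun h => by simpa using congrFun h 1) (mem_slopeArrangement.2 (Or.inl (Or.inr (Or.inl rfl))))
    simpa [linearPoly, Fin.sum_univ_three] using this
  have hz : (X 2 : Poly) ∣ θ 2 := by
    have := linearPoly_dvd_of_mem_tangentModule hθ (v := ![0, 0, 1])
      (fun h => by simpa using congrFun h 2) (mem_slopeArrangement.2 (Or.inl (Or.inr (Or.inr rfl))))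
    simpa [linearPoly, Fin.sum_univ_three] using this
  obtain ⟨g0, hg0⟩ := hx
  obtain ⟨g1, hg1⟩ := hy
  obtain ⟨g2, hg2⟩ := hz
  have hP : pencilPoly 0 1 I ∣ g0 - g1 := by
    refine pencilPoly_dvd lineXY_injective associated_lineXY fun a ha => ?_
    refine sub_dvd_sub_of_dvd (by decide) (fun h => hI (h ▸ ha)) associated_lineXY ?_
    have := linearPoly_dvd_of_mem_tangentModule hθ (v := ![1, -a, 0])
      (fun h => by simpa using congrFun h 0)
      (mem_slopeArrangement.2 (Or.inr (Or.inl ⟨a, ha, rfl⟩)))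
    rw [linearPoly_XY] at this
    convert this using 1
    simp [Fin.sum_univ_three, hg0, hg1]
    ring
  have hQ : pencilPoly 1 2 J ∣ g1 - g2 := by
    refine pencilPoly_dvd lineYZ_injective associated_lineYZ fun a ha => ?_
    refine sub_dvd_sub_of_dvd (by decide) (fun h => hJ (h ▸ ha)) associated_lineYZ ?_
    have := linearPoly_dvd_of_mem_tangentModule hθ (v := ![0, 1, -a])
      (fun h => by simpa using congrFun h 1)
      (mem_slopeArrangement.2 (Or.inr (Or.inr (Or.inl ⟨a, ha, rfl⟩))))
    rw [linearPoly_YZ] at this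
    convert this using 1
    simp [Fin.sum_univ_three, hg1, hg2]
    ring
  have hR : pencilPoly 0 2 K ∣ g0 - g2 := by
    refine pencilPoly_dvd lineXZ_injective associated_lineXZ fun a ha => ?_
    refine sub_dvd_sub_of_dvd (by decide) (fun h => hK (h ▸ ha)) associated_lineXZ ?_
    have := linearPoly_dvd_of_mem_tangentModule hθ (v := ![1, 0, -a])
      (fun h => by simpa using congrFun h 0)
      (mem_slopeArrangement.2 (Or.inr (Or.inr (Or.inr ⟨a, ha, rfl⟩))))
    rw [linearPoly_XZ] at this
    convert this using 1
    simp [Fin.sum_univ_three, hg0, hg2]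
    ring
  obtain ⟨p, hp⟩ := hP
  obtain ⟨q, hq⟩ := hQ
  obtain ⟨r, hr⟩ := hR
  set g : Fin 3 → Poly := ![g0, g1, g2] with hg
  set c : Fin 3 → Poly := ![p, q, -r] with hc
  have h0 : g 0 - g 1 = c 0 * pencilForms I J K 0 := by
    simp only [hg, hc, pencilForms, Matrix.cons_val]
    linear_combination hp
  have h1 : g 1 - g 2 = c 1 * pencilForms I J K 1 := by
    simp only [hg, hc, pencilForms, Matrix.cons_val]
    linear_combination hq
  have h2 : g 2 - g 0 = c 2 * pencilForms I J K 2 := by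
    simp only [hg, hc, pencilForms, Matrix.cons_val]
    linear_combination -hr
  have hθg : θ = fun i => X i * g i := by
    funext i
    fin_cases i
    · exact hg0
    · exact hg1
    · exact hg2
  have hF := sum_syzygyField_mul_pderiv hIn hJn hKn h0 h1 h2
  have hθ' := (mem_tangentModule_of_associated (associated_definingPoly hI hJ hK)).1 hθ
  rw [hθg] at hθ'
  rw [hθ', eq_comm, mul_eq_zero, or_iff_right] at hF
  · refine ⟨c, ?_, ?_⟩
    · rw [mem_syzygies, ← h0, ← h1, ← h2]
      ring
    · rw [hθg]
      funext i
      change X i * fieldQuotients n (pencilForms I J K) c i = _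
      rw [fieldQuotients_unique h0 h1 h2 (sub_eq_zero.1 hF)]
  · have := pencilForms_ne_zero (I := I) (J := J) (K := K)
    exact mul_ne_zero (mul_ne_zero (mul_ne_zero (mul_ne_zero (mul_ne_zero (X_ne_zero 0)
      (X_ne_zero 1)) (X_ne_zero 2)) (this 0)) (this 1)) (this 2)

lemma syzygyField_eq_zero {c : Fin 3 → Poly} (hc : c ∈ syzygies (pencilForms I J K))
    (h : syzygyField n (pencilForms I J K) c = 0) : c = 0 := by
  have hg : ∀ i, fieldQuotients n (pencilForms I J K) c i = 0 := fun i =>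
    (mul_eq_zero.1 (congrFun h i)).resolve_left (X_ne_zero i)
  obtain ⟨h0, h1, h2⟩ := fieldQuotients_sub n hc
  simp only [hg, sub_self, zero_eq_mul, pencilForms_ne_zero, or_false] at h0 h1 h2
  funext i
  fin_cases i
  · exact h0
  · exact h1
  · exact h2

/-- The tangent module of a slope arrangement is isomorphic to the module of syzygies of its
pencil forms. -/
noncomputable def syzygiesEquiv (hI : (0 : ℂ) ∉ I) (hJ : (0 : ℂ) ∉ J) (hK : (0 : ℂ) ∉ K)
    (hIn : I.card = n) (hJn : J.card = n) (hKn : K.card = n) :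
    syzygies (pencilForms I J K) ≃ₗ[Poly] tangentModule (slopeArrangement I J K) :=
  LinearEquiv.ofBijective ((syzygyField n (pencilForms I J K)).restrict
    fun _ hc => syzygyField_mem hI hJ hK hIn hJn hKn hc) <| by
    constructor
    · rw [← LinearMap.ker_eq_bot, LinearMap.ker_eq_bot']
      intro c hc
      exact Subtype.ext (syzygyField_eq_zero c.2 (congrArg Subtype.val hc))
    · rintro ⟨θ, hθ⟩
      obtain ⟨c, hc, h⟩ := exists_syzygyField_eq hI hJ hK hIn hJn hKn hθ
      exact ⟨⟨c, hc⟩, Subtype.ext h⟩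

lemma isHomogeneous_X_mul_pderiv {P : Poly} (hP : P.IsHomogeneous n) (i : Fin 3) :
    (X i * pderiv i P).IsHomogeneous n := by
  cases n with
  | zero =>
    rw [← totalDegree_zero_iff_isHomogeneous, totalDegree_eq_zero_iff_eq_C] at hP
    rw [hP, pderiv_C, mul_zero]
    exact isHomogeneous_zero _ _ _
  | succ n =>
    rw [add_comm n]
    exact (isHomogeneous_X ℂ i).mul (by simpa using hP.pderiv)

/-- A syzygy of degree `d` gives a tangent field of degree `d + n + 1`. -/
lemma isHomogeneousField_syzygiesEquiv (hI : (0 : ℂ) ∉ I) (hJ : (0 : ℂ) ∉ J) (hK : (0 : ℂ) ∉ K)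
    (hIn : I.card = n) (hJn : J.card = n) (hKn : K.card = n)
    {c : syzygies (pencilForms I J K)} {d : ℕ} (hc : ∀ i, (c.1 i).IsHomogeneous d) :
    IsHomogeneousField (syzygiesEquiv hI hJ hK hIn hJn hKn c) (1 + (d + n)) := by
  have hG := isHomogeneous_pencilForms (I := I) (J := J) (K := K) hIn hJn hKn
  have hC : ∀ (a : ℂ) {φ : Poly}, φ.IsHomogeneous (d + n) → (C a * φ).IsHomogeneous (d + n) :=
    fun a φ h => by simpa using (isHomogeneous_C _ a).mul h
  have hr : (radialPart (pencilForms I J K) c.1).IsHomogeneous (d + n) :=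
    (((hc 0).mul (isHomogeneous_X_mul_pderiv (hG 0) 1)).add
      ((hc 1).mul (isHomogeneous_X_mul_pderiv (hG 1) 2))).add
      ((hc 2).mul (isHomogeneous_X_mul_pderiv (hG 2) 0))
  intro i
  refine (isHomogeneous_X ℂ i).mul ?_
  fin_cases i
  · exact hC _ (((hC _ hr).add ((hc 0).mul (hG 0))).sub ((hc 2).mul (hG 2)))
  · exact hC _ (((hC _ hr).add ((hc 1).mul (hG 1))).sub ((hc 0).mul (hG 0)))
  · exact hC _ (((hC _ hr).add ((hc 2).mul (hG 2))).sub ((hc 1).mul (hG 1)))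

end

/-! ### Freeness from a Hilbert–Burch presentation -/

section

variable {G s t : Fin 3 → Poly}

/-- If `G` is the vector of `2 × 2` minors of `(s, t)` and two of its entries are coprime, then
every syzygy of `G` is a combination of `s` and `t`; the coefficients are given by Cramer's rule. -/
lemma exists_eq_of_mem_syzygies (e0 : s 1 * t 2 - s 2 * t 1 = G 0)
    (e1 : s 2 * t 0 - s 0 * t 2 = G 1) (e2 : s 0 * t 1 - s 1 * t 0 = G 2) (h2 : G 2 ≠ 0)
    (hG : IsRelPrime (G 2) (G 0)) {c : Fin 3 → Poly} (hc : c ∈ syzygies G) :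
    ∃ u v : Poly, u • s + v • t = c := by
  rw [mem_syzygies] at hc
  -- The numerators of Cramer's rule for the first two coordinates are divisible by the determinant
  -- `G 2`: their products with `G 0` are, because `c`, `s` and `t` are syzygies.
  obtain ⟨u, hu⟩ : G 2 ∣ c 0 * t 1 - c 1 * t 0 := by
    refine hG.dvd_of_dvd_mul_left ⟨-(c 2 * t 1) + c 1 * t 2, ?_⟩
    rw [← e0, ← e1, ← e2] at hc
    rw [← e0, ← e2]
    linear_combination t 1 * hc
  obtain ⟨v, hv⟩ : G 2 ∣ s 0 * c 1 - s 1 * c 0 := by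
    refine hG.dvd_of_dvd_mul_left ⟨c 2 * s 1 - c 1 * s 2, ?_⟩
    rw [← e0, ← e1, ← e2] at hc
    rw [← e0, ← e2]
    linear_combination -s 1 * hc
  have k0 : u * s 0 + v * t 0 = c 0 := mul_left_cancel₀ h2 (by
    rw [← e2] at hu hv ⊢
    linear_combination -s 0 * hu - t 0 * hv)
  have k1 : u * s 1 + v * t 1 = c 1 := mul_left_cancel₀ h2 (by
    rw [← e2] at hu hv ⊢
    linear_combination -s 1 * hu - t 1 * hv)
  have k2 : u * s 2 + v * t 2 = c 2 := mul_left_cancel₀ h2 (by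
    rw [← k0, ← k1] at hc
    rw [← e0, ← e1] at hc
    rw [← e2] at hc ⊢
    linear_combination -hc)
  refine ⟨u, v, ?_⟩
  funext i
  fin_cases i
  · exact k0
  · exact k1
  · exact k2

/-- The basis `(s, t)` of the syzygies of the vector of `2 × 2` minors of `(s, t)`. -/
lemma exists_basis_syzygies (e0 : s 1 * t 2 - s 2 * t 1 = G 0)
    (e1 : s 2 * t 0 - s 0 * t 2 = G 1) (e2 : s 0 * t 1 - s 1 * t 0 = G 2) (h2 : G 2 ≠ 0)
    (hG : IsRelPrime (G 2) (G 0)) :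
    ∃ β : Module.Basis (Fin 2) Poly (syzygies G), (β 0 : Fin 3 → Poly) = s ∧
      (β 1 : Fin 3 → Poly) = t := by
  have hs : s ∈ syzygies G := by
    rw [mem_syzygies, ← e0, ← e1, ← e2]
    ring
  have ht : t ∈ syzygies G := by
    rw [mem_syzygies, ← e0, ← e1, ← e2]
    ring
  have hli : LinearIndependent Poly ![(⟨s, hs⟩ : syzygies G), ⟨t, ht⟩] := by
    rw [LinearIndependent.pair_iff]
    intro u v h
    have h' := congrArg Subtype.val h
    have k0 : u * s 0 + v * t 0 = 0 := congrFun h' 0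
    have k1 : u * s 1 + v * t 1 = 0 := congrFun h' 1
    refine ⟨(mul_eq_zero.1 (?_ : u * G 2 = 0)).resolve_right h2,
      (mul_eq_zero.1 (?_ : v * G 2 = 0)).resolve_right h2⟩
    · rw [← e2]
      linear_combination t 1 * k0 - t 0 * k1
    · rw [← e2]
      linear_combination s 0 * k1 - s 1 * k0
  refine ⟨Module.Basis.mk hli ?_, ?_, ?_⟩
  · rintro ⟨c, hc⟩ -
    obtain ⟨u, v, h⟩ := exists_eq_of_mem_syzygies e0 e1 e2 h2 hG hc
    refine (Submodule.mem_span_range_iff_exists_fun _).2 ⟨![u, v], ?_⟩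
    rw [Fin.sum_univ_two]
    exact Subtype.ext h
  · simp
  · simp

end

/-! ### Nearly free arrangements are not free -/

/-- The three generators of a nearly free arrangement are minimal, because the entries of the
relation between them have no constant term; so no two elements generate. -/
lemma IsNearlyFreeWithExponents.not_isFree {A : Arrangement} {a b : ℕ}
    (h : IsNearlyFreeWithExponents A a b) : ¬ IsFree A := by
  obtain ⟨hab, θ, r, -, -, -, hspan, h0, h1, h2, -, hr⟩ := h
  rintro ⟨d, e, β, -, -⟩
  have hev : ∀ {p : Poly} {k : ℕ}, p.IsHomogeneous k → 1 ≤ k → constantCoeff p = 0 := by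
    intro p k hp hk
    refine (congrFun constantCoeff_eq p).trans (hp.coeff_eq_zero ?_)
    simp
    omega
  have hr0 : ∀ i, constantCoeff (r i) = 0 := by
    intro i
    fin_cases i
    · exact hev h0 (by omega)
    · exact hev h1 le_rfl
    · exact hev h2 le_rfl
  have hN : ∀ j, ∃ c : Fin 3 → Poly, ∑ k, c k • θ k = β j := fun j =>
    (Submodule.mem_span_range_iff_exists_fun _).1 (hspan ▸ Submodule.mem_top)
  choose N hN using hN
  set M : Fin 3 → Fin 2 → Poly := fun i j => β.repr (θ i) j
  -- Reducing modulo the irrelevant ideal gives a factorization of the `3 × 3` identity matrix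
  -- through `ℂ²`.
  have key : (Matrix.of fun i j => constantCoeff (M i j)) *
      (Matrix.of fun j k => constantCoeff (N j k)) =
      (1 : Matrix (Fin 3) (Fin 3) ℂ) := by
    ext i k
    have hrel : ∑ k, (∑ j, M i j * N j k - if i = k then 1 else 0) • θ k = 0 := by
      have h1 : ∑ j, M i j • β j = θ i := β.sum_repr (θ i)
      have h2 : ∑ k, (∑ j, M i j * N j k) • θ k = θ i := by
        calc ∑ k, (∑ j, M i j * N j k) • θ k = ∑ j, M i j • ∑ k, N j k • θ k := by
              simp only [Finset.sum_smul, Finset.smul_sum, mul_smul]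
              exact Finset.sum_comm
          _ = θ i := by simp only [hN, h1]
      have h3 : ∑ k, (if i = k then (1 : Poly) else 0) • θ k = θ i := by
        simp [ite_smul]
      calc _ = ∑ k, ((∑ j, M i j * N j k) • θ k - (if i = k then (1 : Poly) else 0) • θ k) :=
            Finset.sum_congr rfl fun k _ => sub_smul _ _ _
        _ = 0 := by rw [Finset.sum_sub_distrib, h2, h3, sub_self]
    obtain ⟨q, hq⟩ := (hr _).1 hrel
    have := congrArg constantCoeff (congrFun hq k)
    simp only [Pi.smul_apply, smul_eq_mul, map_mul, hr0, mul_zero, map_sub, map_sum,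
      sub_eq_zero] at this
    simp only [Matrix.mul_apply, Matrix.of_apply, this, Matrix.one_apply]
    split_ifs <;> simp
  have h3 := Matrix.rank_mul_le_left (Matrix.of fun i j => constantCoeff (M i j))
    (Matrix.of fun j k => constantCoeff (N j k))
  rw [key, Matrix.rank_one] at h3
  have h4 := h3.trans (Matrix.rank_le_width _)
  simp at h4

/-! ### Syzygies of three quotients of differences of fifth powers -/

/-- A polynomial that vanishes on the line `x = y = z` lies in the ideal of this line: modulo
`x - y` and `y - z`, every polynomial agrees with its restriction. -/
lemma mem_span_of_aeval_eq_zero {h : Poly} (hh : aeval (fun _ : Fin 3 => (X 0 : Poly)) h = 0) :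
    ∃ h₁ h₂ : Poly, h₁ * (X 0 - X 1) + h₂ * (X 1 - X 2) = h := by
  set I : Ideal Poly := Ideal.span {X 0 - X 1, X 1 - X 2} with hI
  have h1 : (X 0 - X 1 : Poly) ∈ I := Ideal.subset_span (by simp)
  have h2 : (X 1 - X 2 : Poly) ∈ I := Ideal.subset_span (by simp)
  have e : (Ideal.Quotient.mkₐ ℂ I).comp (aeval fun _ : Fin 3 => (X 0 : Poly)) =
      Ideal.Quotient.mkₐ ℂ I := by
    ext i
    simp only [AlgHom.comp_apply, aeval_X, Ideal.Quotient.mkₐ_eq_mk, Ideal.Quotient.eq]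
    fin_cases i
    · simp
    · exact h1
    · simpa using I.add_mem h1 h2
  have := congrArg (fun f : Poly →ₐ[ℂ] Poly ⧸ I => f h) e
  simp only [AlgHom.comp_apply, hh, map_zero, Ideal.Quotient.mkₐ_eq_mk] at this
  exact Ideal.mem_span_pair.1 (Ideal.Quotient.eq_zero_iff_mem.1 this.symm)

/-- The three syzygies of `G` given by the linear one and two Koszul ones. -/
noncomputable def linearKoszulSyzygies (G : Fin 3 → Poly) : Fin 3 → Fin 3 → Poly :=
  ![![X 0 - X 1, X 1 - X 2, X 2 - X 0], ![0, -G 2, G 1], ![G 2, 0, -G 0]]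

/-- If `G = (P, Q, R)` with `P - R = (y - z) K` and `Q - R = -(x - y) K`, a syzygy `(p, q, r)` is a
relation `(p + q + r) R + (p (y - z) - q (x - y)) K = 0`. As `R` is coprime to `K` and does not
vanish on the line `x = y = z`, it follows that `p (y - z) - q (x - y) = h R` with `h` in the ideal
`(x - y, y - z)`; writing out `h` gives the coefficients. -/
lemma exists_eq_linearKoszul {G : Fin 3 → Poly} {K : Poly} (hP : G 0 - G 2 = (X 1 - X 2) * K)
    (hQ : G 1 - G 2 = -((X 0 - X 1) * K)) (hG : IsRelPrime (G 2) (G 0))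
    (hd : aeval (fun _ : Fin 3 => (X 0 : Poly)) (G 2) ≠ 0) {c : Fin 3 → Poly}
    (hc : c ∈ syzygies G) :
    ∃ d : Fin 3 → Poly, ∑ i, d i • linearKoszulSyzygies G i = c := by
  rw [mem_syzygies] at hc
  have h2 : G 2 ≠ 0 := fun h => hd (by rw [h, map_zero])
  have hK : IsRelPrime (G 2) K := fun e he he' => hG he (by
    rw [← sub_add_cancel (G 0) (G 2), hP]
    exact dvd_add (he'.mul_left _) he)
  obtain ⟨h, hh⟩ : G 2 ∣ c 0 * (X 1 - X 2) - c 1 * (X 0 - X 1) := by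
    refine hK.dvd_of_dvd_mul_right ⟨-(c 0 + c 1 + c 2), ?_⟩
    linear_combination hc - c 0 * hP - c 1 * hQ
  have hKh : K * h = -(c 0 + c 1 + c 2) := mul_left_cancel₀ h2 (by
    linear_combination hc - c 0 * hP - c 1 * hQ - K * hh)
  have hh0 : aeval (fun _ : Fin 3 => (X 0 : Poly)) h = 0 := by
    have := congrArg (aeval (fun _ : Fin 3 => (X 0 : Poly))) hh
    simp only [map_sub, map_mul, aeval_X, sub_self, mul_zero] at this
    exact (mul_eq_zero.1 this.symm).resolve_left hd
  obtain ⟨h₁, h₂, hh12⟩ := mem_span_of_aeval_eq_zero hh0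
  have hprime : Prime (X 0 - C 1 * X 1 : Poly) :=
    (associated_lineXY 1).prime (prime_linearForm _)
  rw [C_1, one_mul] at hprime
  obtain ⟨m, hm⟩ : (X 0 - X 1 : Poly) ∣ c 0 - h₂ * G 2 := by
    refine (hprime.dvd_or_dvd (a := X 1 - X 2) ⟨c 1 + h₁ * G 2, ?_⟩).resolve_left ?_
    · linear_combination hh - G 2 * hh12
    · -- The point `(0 : 0 : 1)` lies on `x = y` but not on `y = z`.
      rintro ⟨e, he⟩
      simpa using congrArg (eval ![0, 0, 1]) he
  have hm' : c 1 + h₁ * G 2 = (X 1 - X 2) * m := mul_left_cancel₀ hprime.ne_zero (by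
    linear_combination (X 1 - X 2) * hm - hh + G 2 * hh12)
  refine ⟨![m, h₁, h₂], ?_⟩
  funext i
  rw [Fin.sum_univ_three]
  fin_cases i
  · simp [linearKoszulSyzygies]
    linear_combination -hm
  · simp [linearKoszulSyzygies]
    linear_combination -hm'
  · simp [linearKoszulSyzygies]
    linear_combination h₁ * hQ - h₂ * hP - K * hh12 - hKh + hm + hm'

/-- The relations between the three generating syzygies are the multiples of one of them. -/
lemma linearKoszul_relation {G d : Fin 3 → Poly} {K : Poly} (hP : G 0 - G 2 = (X 1 - X 2) * K)
    (hQ : G 1 - G 2 = -((X 0 - X 1) * K)) (h2 : G 2 ≠ 0) :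
    ∑ i, d i • linearKoszulSyzygies G i = 0 ↔
      ∃ h : Poly, d = h • ![G 2, X 1 - X 2, X 1 - X 0] := by
  rw [Fin.sum_univ_three]
  constructor
  · intro h
    have k0 := congrFun h 0
    have k1 := congrFun h 1
    simp [linearKoszulSyzygies] at k0 k1
    have hprime : Prime (X 0 - C 1 * X 1 : Poly) :=
      (associated_lineXY 1).prime (prime_linearForm _)
    rw [C_1, one_mul] at hprime
    have k : d 1 * (X 0 - X 1) + d 2 * (X 1 - X 2) = 0 := mul_left_cancel₀ h2 (by
      linear_combination (X 1 - X 2) * k0 - (X 0 - X 1) * k1)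
    obtain ⟨m, hm⟩ : (X 0 - X 1 : Poly) ∣ d 2 := by
      refine (hprime.dvd_or_dvd (a := X 1 - X 2) ⟨-d 1, ?_⟩).resolve_left ?_
      · linear_combination k
      · rintro ⟨e, he⟩
        simpa using congrArg (eval ![0, 0, 1]) he
    have hm1 : d 1 = -m * (X 1 - X 2) := mul_left_cancel₀ hprime.ne_zero (by
      linear_combination k - (X 1 - X 2) * hm)
    have hm0 : d 0 = -m * G 2 := mul_left_cancel₀ hprime.ne_zero (by
      linear_combination k0 - G 2 * hm)
    refine ⟨-m, ?_⟩
    funext i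
    fin_cases i
    · exact hm0
    · exact hm1
    · simp
      linear_combination hm
  · rintro ⟨h, rfl⟩
    funext i
    fin_cases i
    · simp [linearKoszulSyzygies]
      ring
    · simp [linearKoszulSyzygies]
      ring
    · simp [linearKoszulSyzygies]
      linear_combination h * (X 1 - X 2) * hQ + h * (X 0 - X 1) * hP

/-! ### Sets of roots of unity -/

section

variable {ζ : ℂ} {N : ℕ}

open Classical in
/-- The set of the powers `ζ ^ e`, `e ∈ E`. -/
noncomputable def powers (ζ : ℂ) (E : Finset ℕ) : Finset ℂ := E.image (ζ ^ ·)

lemma injOn_pow (hζ : IsPrimitiveRoot ζ N) {E : Finset ℕ} (hE : E ⊆ Finset.range N) :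
    Set.InjOn (ζ ^ ·) (E : Set ℕ) := fun _ hi _ hj h =>
  hζ.pow_inj (Finset.mem_range.1 (hE hi)) (Finset.mem_range.1 (hE hj)) h

lemma card_powers (hζ : IsPrimitiveRoot ζ N) {E : Finset ℕ} (hE : E ⊆ Finset.range N) :
    (powers ζ E).card = E.card :=
  Finset.card_image_of_injOn (injOn_pow hζ hE)

lemma zero_notMem_powers (hζ : IsPrimitiveRoot ζ N) (hN : N ≠ 0) (E : Finset ℕ) :
    (0 : ℂ) ∉ powers ζ E := by
  intro h
  obtain ⟨e, -, he⟩ := Finset.mem_image.1 h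
  exact pow_ne_zero e (hζ.ne_zero hN) he

lemma nthRootsFinset_eq_powers (hζ : IsPrimitiveRoot ζ N) (hN : N ≠ 0) :
    Polynomial.nthRootsFinset N (1 : ℂ) = powers ζ (Finset.range N) := by
  have : NeZero N := ⟨hN⟩
  ext x
  rw [Polynomial.mem_nthRootsFinset (Nat.pos_of_ne_zero hN), powers, Finset.mem_image]
  constructor
  · intro h
    obtain ⟨i, hi, h⟩ := hζ.eq_pow_of_pow_eq_one h
    exact ⟨i, Finset.mem_range.2 hi, h⟩
  · rintro ⟨i, -, rfl⟩
    rw [← pow_mul, mul_comm, pow_mul, hζ.pow_eq_one, one_pow]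

lemma powers_sdiff [DecidableEq ℂ] (hζ : IsPrimitiveRoot ζ N) {E : Finset ℕ}
    (hE : E ⊆ Finset.range N) :
    powers ζ (Finset.range N) \ powers ζ E = powers ζ (Finset.range N \ E) := by
  ext x
  simp only [powers, Finset.mem_sdiff, Finset.mem_image]
  constructor
  · rintro ⟨⟨i, hi, rfl⟩, h⟩
    exact ⟨i, ⟨hi, fun h' => h ⟨i, h', rfl⟩⟩, rfl⟩
  · rintro ⟨i, ⟨hi, h⟩, rfl⟩
    refine ⟨⟨i, hi, rfl⟩, ?_⟩
    rintro ⟨j, hj, hij⟩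
    exact h (injOn_pow hζ subset_rfl (hE hj) hi hij ▸ hj)

/-- The triple points off the sides correspond to the triples of exponents with `i + j ≡ k`. -/
lemma card_triplePoints_powers (hζ : IsPrimitiveRoot ζ N) (hN : N ≠ 0) {E₁ E₂ E₃ : Finset ℕ}
    (h₂ : E₂ ⊆ Finset.range N) (h₃ : E₃ ⊆ Finset.range N) :
    (triplePoints (powers ζ E₁) (powers ζ E₂) (powers ζ E₃)).card =
      ((E₃ ×ˢ E₂).filter fun q => ∃ i ∈ E₁, (i + q.2) % N = q.1).card := by
  classical
  have h0 := hζ.ne_zero hN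
  have e : triplePoints (powers ζ E₁) (powers ζ E₂) (powers ζ E₃) =
      ((E₃ ×ˢ E₂).filter fun q => ∃ i ∈ E₁, (i + q.2) % N = q.1).image
        fun q => (ζ ^ q.1, ζ ^ q.2) := by
    have key : ∀ k ∈ E₃, ∀ j ∈ E₂,
        ζ ^ k / ζ ^ j ∈ powers ζ E₁ ↔ ∃ i ∈ E₁, (i + j) % N = k := by
      intro k hk j hj
      rw [powers, Finset.mem_image]
      refine exists_congr fun i => and_congr_right fun hi => ?_
      rw [eq_div_iff (pow_ne_zero _ h0), ← pow_add, pow_eq_pow_mod (i + j) hζ.pow_eq_one]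
      exact ⟨fun h => hζ.pow_inj (Nat.mod_lt _ (Nat.pos_of_ne_zero hN))
        (Finset.mem_range.1 (h₃ hk)) h, fun h => by rw [h]⟩
    ext ⟨x, y⟩
    simp only [triplePoints, Finset.mem_filter, Finset.mem_product, Finset.mem_image, Prod.mk.injEq,
      Prod.exists]
    constructor
    · rintro ⟨⟨hx, hy⟩, h⟩
      obtain ⟨k, hk, rfl⟩ := Finset.mem_image.1 hx
      obtain ⟨j, hj, rfl⟩ := Finset.mem_image.1 hy
      exact ⟨k, j, ⟨⟨hk, hj⟩, (key k hk j hj).1 h⟩, rfl, rfl⟩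
    · rintro ⟨k, j, ⟨⟨hk, hj⟩, h⟩, rfl, rfl⟩
      exact ⟨⟨Finset.mem_image_of_mem _ hk, Finset.mem_image_of_mem _ hj⟩, (key k hk j hj).2 h⟩
  rw [e, Finset.card_image_of_injOn]
  rintro ⟨k, j⟩ h ⟨k', j'⟩ h' hkj
  simp only [Finset.coe_filter, Finset.mem_product, Set.mem_ofPred_eq] at h h'
  obtain ⟨hk, hj⟩ := Prod.mk.inj hkj
  rw [injOn_pow hζ h₃ h.1.1 h'.1.1 hk, injOn_pow hζ h₂ h.1.2 h'.1.2 hj]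

lemma pencilPoly_powers (hζ : IsPrimitiveRoot ζ N) {E : Finset ℕ} (hE : E ⊆ Finset.range N)
    (i j : Fin 3) : pencilPoly i j (powers ζ E) = ∏ e ∈ E, (X i - C ζ ^ e * X j) := by
  rw [pencilPoly, powers, Finset.prod_image (injOn_pow hζ hE)]
  simp

end

/-! ### The free arrangement -/

lemma sq_sub_add_one_eq_zero {ζ : ℂ} (hζ : IsPrimitiveRoot ζ 6) : ζ ^ 2 - ζ + 1 = 0 := by
  have h3 : ζ ^ 3 - 1 ≠ 0 := sub_ne_zero.2 (hζ.pow_ne_one_of_pos_of_lt (by decide) (by decide))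
  have h2 : ζ ^ 2 ≠ 1 := hζ.pow_ne_one_of_pos_of_lt (by decide) (by decide)
  have h1 : ζ + 1 ≠ 0 := fun h => h2 (by linear_combination (ζ - 1) * h)
  refine (mul_eq_zero.1 (?_ : (ζ ^ 3 - 1) * (ζ + 1) * (ζ ^ 2 - ζ + 1) = 0)).resolve_left
    (mul_ne_zero h3 h1)
  linear_combination hζ.pow_eq_one

lemma exampleA₀_eq {ζ : ℂ} (hζ : IsPrimitiveRoot ζ 6) :
    exampleA₀ ζ = slopeArrangement (powers ζ {0, 1, 3, 5}) (powers ζ {2, 3, 4, 5})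
      (powers ζ {2, 3, 4, 5}) := by
  classical
  have h0 := zero_notMem_powers hζ (by decide) (Finset.range 6)
  have hs : ∀ {E : Finset ℕ}, E ⊆ Finset.range 6 → powers ζ E ⊆ powers ζ (Finset.range 6) :=
    fun h => Finset.image_subset_image h
  have e : fullMonomial 6 = slopeArrangement (powers ζ (Finset.range 6))
      (powers ζ (Finset.range 6)) (powers ζ (Finset.range 6)) := by
    rw [← nthRootsFinset_eq_powers hζ (by decide)]
    rfl
  rw [exampleA₀, e, slopeArrangement_sdiff (I' := powers ζ {2, 4}) (J' := powers ζ {0, 1})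
    (K' := powers ζ {0, 1}) h0 h0 h0 (hs (by decide)) (hs (by decide)) (hs (by decide)),
    powers_sdiff hζ (by decide), powers_sdiff hζ (by decide)]
  · rfl
  · intro l
    simp only [powers, Finset.image_insert, Finset.image_singleton, Finset.mem_insert,
      Finset.mem_singleton, exists_eq_or_imp, exists_eq_left, pow_zero, pow_one, eq_comm (b := l)]
    constructor
    · rintro (rfl | rfl | rfl | rfl | rfl | rfl) <;> simp
    · rintro ((rfl | rfl) | (rfl | rfl) | rfl | rfl) <;> simp

/-- A syzygy of degree two of the pencil forms of `exampleA₀ ζ`; together with `quadricSyzygy₂ ζ` it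
spans the space of all of them. The pair is scaled so that its minors are exactly these forms. -/
noncomputable def quadricSyzygy₁ (ζ : ℂ) : Fin 3 → Poly :=
  ![-C ζ * X 2 ^ 2 - (1 + C ζ) * X 1 * X 2 - (1 + C ζ) * X 0 * X 2 - X 0 * X 1,
    2 * C ζ * X 2 ^ 2 - (1 + C ζ) * X 1 * X 2 + (1 + C ζ) * X 0 * X 2 - X 0 * X 1 + X 0 ^ 2,
    -2 * C ζ * X 2 ^ 2 - (1 + C ζ) * X 1 * X 2 - X 1 ^ 2 + (1 + C ζ) * X 0 * X 2 + X 0 * X 1]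

/-- The companion of `quadricSyzygy₁ ζ`; its entries are binary forms, of degree two, in the same
variables as the corresponding pencil forms. -/
noncomputable def quadricSyzygy₂ (ζ : ℂ) : Fin 3 → Poly :=
  ![-(X 0 ^ 2 + X 0 * X 1 + X 1 ^ 2),
    -C ζ * X 2 ^ 2 + (1 + C ζ) * X 1 * X 2 - X 1 ^ 2,
    C ζ * X 2 ^ 2 - (1 + C ζ) * X 0 * X 2 + X 0 ^ 2]

lemma isHomogeneous_X_mul_X (i j : Fin 3) : (X i * X j : Poly).IsHomogeneous 2 :=
  (isHomogeneous_X ℂ i).mul (isHomogeneous_X ℂ j)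

lemma isHomogeneous_C_mul_X_mul_X (a : ℂ) (i j : Fin 3) :
    (C a * (X i * X j) : Poly).IsHomogeneous 2 := by
  simpa using (isHomogeneous_C _ a).mul (isHomogeneous_X_mul_X i j)

lemma isHomogeneous_quadricSyzygy₁ (ζ : ℂ) (i : Fin 3) :
    (quadricSyzygy₁ ζ i).IsHomogeneous 2 := by
  have h := isHomogeneous_C_mul_X_mul_X
  fin_cases i
  · refine (congrArg (fun p : Poly => p.IsHomogeneous 2) ?_).mpr
      ((((h (-ζ) 2 2).sub (h (1 + ζ) 1 2)).sub (h (1 + ζ) 0 2)).sub (h 1 0 1))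
    simp [quadricSyzygy₁]
    ring
  · refine (congrArg (fun p : Poly => p.IsHomogeneous 2) ?_).mpr
      (((((h (2 * ζ) 2 2).sub (h (1 + ζ) 1 2)).add (h (1 + ζ) 0 2)).sub (h 1 0 1)).add
      (h 1 0 0))
    simp [quadricSyzygy₁, map_ofNat C 2]
    ring
  · refine (congrArg (fun p : Poly => p.IsHomogeneous 2) ?_).mpr
      (((((h (-2 * ζ) 2 2).sub (h (1 + ζ) 1 2)).sub (h 1 1 1)).add (h (1 + ζ) 0 2)).add
      (h 1 0 1))
    simp [quadricSyzygy₁, map_ofNat C 2]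
    ring

lemma isHomogeneous_quadricSyzygy₂ (ζ : ℂ) (i : Fin 3) :
    (quadricSyzygy₂ ζ i).IsHomogeneous 2 := by
  have h := isHomogeneous_C_mul_X_mul_X
  fin_cases i
  · refine (congrArg (fun p : Poly => p.IsHomogeneous 2) ?_).mpr
      (((h (-1) 0 0).sub (h 1 0 1)).sub (h 1 1 1))
    simp [quadricSyzygy₂]
    ring
  · refine (congrArg (fun p : Poly => p.IsHomogeneous 2) ?_).mpr
      (((h (-ζ) 2 2).add (h (1 + ζ) 1 2)).sub (h 1 1 1))
    simp [quadricSyzygy₂]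
    ring
  · refine (congrArg (fun p : Poly => p.IsHomogeneous 2) ?_).mpr
      (((h ζ 2 2).sub (h (1 + ζ) 0 2)).add (h 1 0 0))
    simp [quadricSyzygy₂]
    ring

/-- The quartic `∏ (x_i - ζ ^ e x_j)`, `e = 2, 3, 4, 5`. -/
lemma pencilPoly_consecutive {ζ : ℂ} (hζ : IsPrimitiveRoot ζ 6) (i j : Fin 3) :
    pencilPoly i j (powers ζ {2, 3, 4, 5}) = X i ^ 4 + (1 + C ζ) * X i ^ 3 * X j +
      2 * C ζ * X i ^ 2 * X j ^ 2 + (2 * C ζ - 1) * X i * X j ^ 3 + (C ζ - 1) * X j ^ 4 := by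
  have hz : (C ζ : Poly) ^ 2 - C ζ + 1 = 0 := by
    rw [← C_pow, ← C_sub, ← C_1, ← C_add, sq_sub_add_one_eq_zero hζ, C_0]
  have h2 : (C ζ : Poly) ^ 2 = C ζ - 1 := by linear_combination hz
  have h3 : (C ζ : Poly) ^ 3 = -1 := by linear_combination (C ζ + 1) * hz
  have h4 : (C ζ : Poly) ^ 4 = -C ζ := by linear_combination (C ζ ^ 2 + C ζ) * hz
  have h5 : (C ζ : Poly) ^ 5 = 1 - C ζ := by linear_combination (C ζ ^ 3 + C ζ ^ 2 - 1) * hz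
  rw [pencilPoly_powers hζ (by decide)]
  simp only [Finset.prod_insert (by decide : 2 ∉ ({3, 4, 5} : Finset ℕ)),
    Finset.prod_insert (by decide : 3 ∉ ({4, 5} : Finset ℕ)),
    Finset.prod_insert (by decide : 4 ∉ ({5} : Finset ℕ)), Finset.prod_singleton, h2, h3, h4, h5]
  linear_combination (-X j ^ 2 * (X i ^ 2 + C ζ * X i * X j + (C ζ - 1) * X j ^ 2)) * hz

/-- The quartic `(x_i - x_j) (x_i ^ 3 + x_j ^ 3)`. -/
lemma pencilPoly_nonconsecutive {ζ : ℂ} (hζ : IsPrimitiveRoot ζ 6) (i j : Fin 3) :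
    pencilPoly i j (powers ζ {0, 1, 3, 5}) =
      X i ^ 4 - X i ^ 3 * X j + X i * X j ^ 3 - X j ^ 4 := by
  have hz : (C ζ : Poly) ^ 2 - C ζ + 1 = 0 := by
    rw [← C_pow, ← C_sub, ← C_1, ← C_add, sq_sub_add_one_eq_zero hζ, C_0]
  have h3 : (C ζ : Poly) ^ 3 = -1 := by linear_combination (C ζ + 1) * hz
  have h5 : (C ζ : Poly) ^ 5 = 1 - C ζ := by linear_combination (C ζ ^ 3 + C ζ ^ 2 - 1) * hz
  rw [pencilPoly_powers hζ (by decide)]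
  simp only [Finset.prod_insert (by decide : 0 ∉ ({1, 3, 5} : Finset ℕ)),
    Finset.prod_insert (by decide : 1 ∉ ({3, 5} : Finset ℕ)),
    Finset.prod_insert (by decide : 3 ∉ ({5} : Finset ℕ)), Finset.prod_singleton, h3, h5,
    pow_zero, pow_one]
  linear_combination (-(X i ^ 2 - X j ^ 2) * X j ^ 2) * hz

lemma isRelPrime_pencilForms {I J K : Finset ℂ} (hI : (0 : ℂ) ∉ I) :
    IsRelPrime (pencilForms I J K 2) (pencilForms I J K 0) := by
  refine isRelPrime_pencilPoly associated_lineXZ associated_lineXY fun c _ a ha h => hI ?_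
  have : 0 = a := by
    simp [lineXY, lineXZ, mk_eq_mk_iff_cross] at h
    simp [h]
  exact this ▸ ha

/-- The pencil forms of `exampleA₀ ζ` are the `2 × 2` minors of a matrix of quadrics, whose columns
give tangent fields of degree `1 + (2 + 4) = 7`. -/
lemma isFreeWithExponents_exampleA₀ {ζ : ℂ} (hζ : IsPrimitiveRoot ζ 6) :
    IsFreeWithExponents (exampleA₀ ζ) 7 7 := by
  have h0 := zero_notMem_powers hζ (by decide)
  have hz : (C ζ : Poly) ^ 2 - C ζ + 1 = 0 := by
    rw [← C_pow, ← C_sub, ← C_1, ← C_add, sq_sub_add_one_eq_zero hζ, C_0]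
  obtain ⟨β, hs, ht⟩ := exists_basis_syzygies (G := pencilForms (powers ζ {0, 1, 3, 5})
    (powers ζ {2, 3, 4, 5}) (powers ζ {2, 3, 4, 5})) (s := quadricSyzygy₁ ζ)
    (t := quadricSyzygy₂ ζ)
    (by
      rw [pencilForms_zero, pencilPoly_nonconsecutive hζ]
      -- Here and below, `ζ ^ 2 - ζ + 1` is multiplied by the coefficient of `ζ ^ 2` in the minor.
      simp only [quadricSyzygy₁, quadricSyzygy₂, Matrix.cons_val]
      linear_combination ((2 * X 2 ^ 2 - X 1 * X 2 + X 0 * X 2) * (X 2 ^ 2 - X 0 * X 2) -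
        (-2 * X 2 ^ 2 - X 1 * X 2 + X 0 * X 2) * (-X 2 ^ 2 + X 1 * X 2)) * hz)
    (by
      rw [pencilForms_one, pencilPoly_consecutive hζ]
      simp only [quadricSyzygy₁, quadricSyzygy₂, Matrix.cons_val]
      linear_combination ((X 2 ^ 2 + X 1 * X 2 + X 0 * X 2) * (X 2 ^ 2 - X 0 * X 2)) * hz)
    (by
      rw [pencilForms_two, pencilPoly_consecutive hζ]
      simp only [quadricSyzygy₁, quadricSyzygy₂, Matrix.cons_val]
      linear_combination (-(X 2 ^ 2 + X 1 * X 2 + X 0 * X 2) * (-X 2 ^ 2 + X 1 * X 2)) * hz)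
    (pencilForms_ne_zero 2) (isRelPrime_pencilForms (h0 _))
  rw [exampleA₀_eq hζ]
  refine ⟨β.map (syzygiesEquiv (n := 4) (h0 _) (h0 _) (h0 _) (card_powers hζ (by decide))
    (card_powers hζ (by decide)) (card_powers hζ (by decide))), ?_, ?_⟩
  · rw [Module.Basis.map_apply]
    exact isHomogeneousField_syzygiesEquiv (d := 2) _ _ _ _ _ _ fun i =>
      hs ▸ isHomogeneous_quadricSyzygy₁ ζ i
  · rw [Module.Basis.map_apply]
    exact isHomogeneousField_syzygiesEquiv (d := 2) _ _ _ _ _ _ fun i =>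
      ht ▸ isHomogeneous_quadricSyzygy₂ ζ i

/-! ### The nearly free arrangement -/

lemma exampleA₁_eq {ζ : ℂ} (hζ : IsPrimitiveRoot ζ 5) :
    exampleA₁ = slopeArrangement (powers ζ {1, 2, 3, 4}) (powers ζ {1, 2, 3, 4})
      (powers ζ {1, 2, 3, 4}) := by
  classical
  have h0 := zero_notMem_powers hζ (by decide) (Finset.range 5)
  have hs : powers ζ {0} ⊆ powers ζ (Finset.range 5) := Finset.image_subset_image (by decide)
  have e : fullMonomial 5 = slopeArrangement (powers ζ (Finset.range 5))
      (powers ζ (Finset.range 5)) (powers ζ (Finset.range 5)) := by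
    rw [← nthRootsFinset_eq_powers hζ (by decide)]
    rfl
  rw [exampleA₁, e, slopeArrangement_sdiff (I' := powers ζ {0}) (J' := powers ζ {0})
    (K' := powers ζ {0}) h0 h0 h0 hs hs hs, powers_sdiff hζ (by decide)]
  · rfl
  · intro l
    simp only [powers, Finset.image_singleton, Finset.mem_insert, Finset.mem_singleton,
      exists_eq_left, pow_zero, eq_comm (b := l)]
    constructor
    · rintro (rfl | rfl | rfl) <;> simp
    · rintro (rfl | rfl | rfl) <;> simp

/-- The quartic `(x_i ^ 5 - x_j ^ 5) / (x_i - x_j)`. -/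
lemma pencilPoly_fifth {ζ : ℂ} (hζ : IsPrimitiveRoot ζ 5) (i j : Fin 3) :
    pencilPoly i j (powers ζ {1, 2, 3, 4}) =
      X i ^ 4 + X i ^ 3 * X j + X i ^ 2 * X j ^ 2 + X i * X j ^ 3 + X j ^ 4 := by
  have hζ' : 1 + ζ + ζ ^ 2 + ζ ^ 3 + ζ ^ 4 = 0 := by
    have := hζ.geom_sum_eq_zero (by decide)
    simpa [Finset.sum_range_succ] using this
  have hz : 1 + C ζ + C ζ ^ 2 + C ζ ^ 3 + C ζ ^ 4 = (0 : Poly) := by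
    rw [← C_0, ← hζ']
    simp
  rw [pencilPoly_powers hζ (by decide)]
  simp only [Finset.prod_insert (by decide : 1 ∉ ({2, 3, 4} : Finset ℕ)),
    Finset.prod_insert (by decide : 2 ∉ ({3, 4} : Finset ℕ)),
    Finset.prod_insert (by decide : 3 ∉ ({4} : Finset ℕ)), Finset.prod_singleton, pow_one]
  linear_combination (-(X i ^ 3 * X j) + (C ζ ^ 3 + C ζ - 1) * X i ^ 2 * X j ^ 2 -
    (C ζ ^ 5 - C ζ + 1) * X i * X j ^ 3 + (C ζ ^ 5 + 1) * (C ζ - 1) * X j ^ 4) * hz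

/-- The linear syzygy and the two Koszul syzygies have degrees `1`, `4`, `4`, so the tangent fields
have degrees `6`, `9`, `9`. -/
lemma isNearlyFreeWithExponents_exampleA₁ : IsNearlyFreeWithExponents exampleA₁ 6 9 := by
  obtain ⟨ζ, hζ⟩ : ∃ ζ : ℂ, IsPrimitiveRoot ζ 5 := ⟨_, Complex.isPrimitiveRoot_exp 5 (by decide)⟩
  rw [exampleA₁_eq hζ]
  have h0 := zero_notMem_powers hζ (by decide) {1, 2, 3, 4}
  have hc : (powers ζ {1, 2, 3, 4}).card = 4 := card_powers hζ (by decide)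
  set E := powers ζ {1, 2, 3, 4} with hE
  set G := pencilForms E E E with hG
  set φ := syzygiesEquiv h0 h0 h0 hc hc hc with hφ
  have g0 : G 0 = _ := pencilPoly_fifth hζ 0 1
  have g1 : G 1 = _ := pencilPoly_fifth hζ 1 2
  have g2 : G 2 = _ := pencilPoly_fifth hζ 0 2
  have hP : G 0 - G 2 = (X 1 - X 2) * (X 0 ^ 3 + X 0 ^ 2 * (X 1 + X 2) +
      X 0 * (X 1 ^ 2 + X 1 * X 2 + X 2 ^ 2) +
      (X 1 ^ 3 + X 1 ^ 2 * X 2 + X 1 * X 2 ^ 2 + X 2 ^ 3)) := by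
    rw [g0, g2]
    ring
  have hQ : G 1 - G 2 = -((X 0 - X 1) * (X 0 ^ 3 + X 0 ^ 2 * (X 1 + X 2) +
      X 0 * (X 1 ^ 2 + X 1 * X 2 + X 2 ^ 2) +
      (X 1 ^ 3 + X 1 ^ 2 * X 2 + X 1 * X 2 ^ 2 + X 2 ^ 3))) := by
    rw [g1, g2]
    ring
  have hd : aeval (fun _ : Fin 3 => (X 0 : Poly)) (G 2) ≠ 0 := by
    intro h
    have := congrArg (eval 1) h
    rw [g2] at this
    simp at this
    norm_num at this
  have hGh : ∀ i, (G i).IsHomogeneous 4 := isHomogeneous_pencilForms hc hc hc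
  have hXX : ∀ i j : Fin 3, (X i - X j : Poly).IsHomogeneous 1 := fun i j =>
    (isHomogeneous_X ℂ i).sub (isHomogeneous_X ℂ j)
  have hmem : ∀ i, linearKoszulSyzygies G i ∈ syzygies G := by
    intro i
    rw [mem_syzygies]
    fin_cases i
    · simp [linearKoszulSyzygies]
      linear_combination (X 0 - X 1) * hP + (X 1 - X 2) * hQ
    · simp [linearKoszulSyzygies]
      ring
    · simp [linearKoszulSyzygies]
      ring
  have hsum : ∀ d : Fin 3 → Poly, ((∑ i, d i • (⟨_, hmem i⟩ : syzygies G) : syzygies G) :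
      Fin 3 → Poly) = ∑ i, d i • linearKoszulSyzygies G i := fun d => by
    simp
  have hsum' : ∀ d : Fin 3 → Poly, ∑ i, d i • φ ⟨_, hmem i⟩ =
      φ (∑ i, d i • (⟨_, hmem i⟩ : syzygies G)) := fun d => by
    rw [map_sum]
    exact Finset.sum_congr rfl fun i _ => (φ.map_smul _ _).symm
  have hG2 : G 2 ≠ 0 := pencilForms_ne_zero 2
  refine ⟨by decide, fun i => φ ⟨_, hmem i⟩, ![G 2, X 1 - X 2, X 1 - X 0], ?_, ?_, ?_, ?_,
    hGh 2, hXX 1 2, hXX 1 0, fun h => hG2 (congrFun h 0), fun d => ?_⟩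
  · refine isHomogeneousField_syzygiesEquiv (d := 1) _ _ _ _ _ _ fun i => ?_
    fin_cases i
    · exact hXX 0 1
    · exact hXX 1 2
    · exact hXX 2 0
  · refine isHomogeneousField_syzygiesEquiv (d := 4) _ _ _ _ _ _ fun i => ?_
    fin_cases i
    · exact isHomogeneous_zero _ _ _
    · exact (hGh 2).neg
    · exact hGh 1
  · refine isHomogeneousField_syzygiesEquiv (d := 4) _ _ _ _ _ _ fun i => ?_
    fin_cases i
    · exact hGh 2
    · exact isHomogeneous_zero _ _ _
    · exact (hGh 0).neg
  · rw [eq_top_iff]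
    rintro θ -
    obtain ⟨d, hdc⟩ := exists_eq_linearKoszul hP hQ (isRelPrime_pencilForms h0) hd (φ.symm θ).2
    refine (Submodule.mem_span_range_iff_exists_fun _).2 ⟨d, ?_⟩
    rw [hsum', ← LinearEquiv.eq_symm_apply]
    exact Subtype.ext ((hsum d).trans hdc)
  · rw [hsum', φ.map_eq_zero_iff, ← linearKoszul_relation hP hQ hG2, ← hsum,
      Submodule.coe_eq_zero]

/-! ### Combinatorics of the two arrangements -/

lemma combinatorics_slopeArrangement {I J K : Finset ℂ} (hI : (0 : ℂ) ∉ I) (hJ : (0 : ℂ) ∉ J)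
    (hK : (0 : ℂ) ∉ K) (hIn : I.card = 4) (hJn : J.card = 4) (hKn : K.card = 4)
    (hT : (triplePoints I J K).card = 12) :
    (slopeArrangement I J K).card = 15 ∧ IsTriangular (slopeArrangement I J K) 5 5 5 ∧
      t (slopeArrangement I J K) 2 = 24 ∧ t (slopeArrangement I J K) 3 = 12 ∧
      t (slopeArrangement I J K) 6 = 3 ∧
      ∀ i, 2 ≤ i → i ≠ 2 → i ≠ 3 → i ≠ 6 → t (slopeArrangement I J K) i = 0 := by
  refine ⟨?_, isTriangular_slopeArrangement hI hJ hK hIn hJn hKn, ?_, ?_,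
    t_add_two_slopeArrangement hI hJ hK hIn hJn hKn (by decide),
    fun i hi h2 h3 h6 => t_slopeArrangement_eq_zero hI hJ hK hIn hJn hKn hi h2 h3 h6⟩
  · rw [card_slopeArrangement hI hJ hK, hIn, hJn, hKn]
  · rw [t_two_slopeArrangement hI hJ hK hIn hJn hKn (by decide), hT]
    rfl
  · rw [t_three_slopeArrangement hI hJ hK hIn hJn hKn (by decide), hT]

end LineArr

theorem mainTheorem4 :
    (∃ A B : LineArr.Arrangement,
      LineArr.SameWeakCombinatorics A B ∧ LineArr.IsFree A ∧ ¬ LineArr.IsFree B) ∧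
    (∀ ζ : ℂ, IsPrimitiveRoot ζ 6 →
      (LineArr.exampleA₀ ζ).card = 15 ∧
      LineArr.IsTriangular (LineArr.exampleA₀ ζ) 5 5 5 ∧
      LineArr.t (LineArr.exampleA₀ ζ) 2 = 24 ∧
      LineArr.t (LineArr.exampleA₀ ζ) 3 = 12 ∧
      LineArr.t (LineArr.exampleA₀ ζ) 6 = 3 ∧
      (∀ i, 2 ≤ i → i ≠ 2 → i ≠ 3 → i ≠ 6 → LineArr.t (LineArr.exampleA₀ ζ) i = 0) ∧
      LineArr.IsFreeWithExponents (LineArr.exampleA₀ ζ) 7 7) ∧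
    (LineArr.exampleA₁.card = 15 ∧
      LineArr.IsTriangular LineArr.exampleA₁ 5 5 5 ∧
      LineArr.t LineArr.exampleA₁ 2 = 24 ∧
      LineArr.t LineArr.exampleA₁ 3 = 12 ∧
      LineArr.t LineArr.exampleA₁ 6 = 3 ∧
      (∀ i, 2 ≤ i → i ≠ 2 → i ≠ 3 → i ≠ 6 → LineArr.t LineArr.exampleA₁ i = 0) ∧
      ¬ LineArr.IsFree LineArr.exampleA₁ ∧
      LineArr.IsNearlyFreeWithExponents LineArr.exampleA₁ 6 9) := by
  have comb₀ : ∀ ζ : ℂ, IsPrimitiveRoot ζ 6 → _ := fun ζ hζ =>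
    LineArr.combinatorics_slopeArrangement
      (LineArr.zero_notMem_powers hζ (by decide) {0, 1, 3, 5})
      (LineArr.zero_notMem_powers hζ (by decide) {2, 3, 4, 5})
      (LineArr.zero_notMem_powers hζ (by decide) {2, 3, 4, 5})
      (LineArr.card_powers hζ (by decide)) (LineArr.card_powers hζ (by decide))
      (LineArr.card_powers hζ (by decide))
      ((LineArr.card_triplePoints_powers hζ (by decide) (by decide) (by decide)).trans (by decide))
  obtain ⟨ω, hω⟩ : ∃ ω : ℂ, IsPrimitiveRoot ω 5 := ⟨_, Complex.isPrimitiveRoot_exp 5 (by decide)⟩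
  have comb₁ := LineArr.combinatorics_slopeArrangement
    (LineArr.zero_notMem_powers hω (by decide) {1, 2, 3, 4})
    (LineArr.zero_notMem_powers hω (by decide) {1, 2, 3, 4})
    (LineArr.zero_notMem_powers hω (by decide) {1, 2, 3, 4})
    (LineArr.card_powers hω (by decide)) (LineArr.card_powers hω (by decide))
    (LineArr.card_powers hω (by decide))
    ((LineArr.card_triplePoints_powers hω (by decide) (by decide) (by decide)).trans (by decide))
  rw [← LineArr.exampleA₁_eq hω] at comb₁
  have hnf := LineArr.isNearlyFreeWithExponents_exampleA₁
  obtain ⟨c1, d1, e1, f1, g1, k1⟩ := comb₁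
  refine ⟨?_, fun ζ hζ => ?_, c1, d1, e1, f1, g1, k1, hnf.not_isFree, hnf⟩
  · obtain ⟨ζ, hζ⟩ : ∃ ζ : ℂ, IsPrimitiveRoot ζ 6 := ⟨_, Complex.isPrimitiveRoot_exp 6 (by decide)⟩
    obtain ⟨c0, -, e0, f0, g0, k0⟩ := comb₀ ζ hζ
    rw [← LineArr.exampleA₀_eq hζ] at c0 e0 f0 g0 k0
    refine ⟨LineArr.exampleA₀ ζ, LineArr.exampleA₁, ⟨c0.trans c1.symm, fun i hi => ?_⟩,
      ⟨7, 7, LineArr.isFreeWithExponents_exampleA₀ hζ⟩, hnf.not_isFree⟩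
    by_cases h2 : i = 2
    · rw [h2, e0, e1]
    by_cases h3 : i = 3
    · rw [h3, f0, f1]
    by_cases h6 : i = 6
    · rw [h6, g0, g1]
    rw [k0 i hi h2 h3 h6, k1 i hi h2 h3 h6]
  · obtain ⟨c0, d0, e0, f0, g0, k0⟩ := comb₀ ζ hζ
    rw [← LineArr.exampleA₀_eq hζ] at c0 d0 e0 f0 g0 k0
    exact ⟨c0, d0, e0, f0, g0, k0, LineArr.isFreeWithExponents_exampleA₀ hζ⟩
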